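/- **Setting.** Let $d\ge 0$, $n\ge 1$ be integers, $\mu$ a Borel probability measure on $\mathbb R^d$ and $k:\mathbb R^d\times\mathbb R^d\to\mathbb R$ a positive semi-definite kernel. Write $\partial_\ell$, $\partial_{\ell+d}$ for the partial derivatives in the $\ell$-th coordinate of the first and of the second argument, and $\nabla_1k=(\partial_1k,\dots,\partial_dk)^\top$. For probability measures $P,Q$ put $$\operatorname{MMD}^2(P,Q)=\iint k(x,y)\,\mathrm d(P-Q)(x)\,\mathrm d(P-Q)(y),\qquad \Phi(z,w)=\mathbb E_{Y\sim\mu}[\nabla_1k(z,Y)]-\nabla_1k(z,w).$$ Assume, for a constant $\kappa\ge 1$ and all $\ell,r\in\{1,\dots,d\}$: 1. $\sup_x\int k(x,y)\,\mathrm d\mu(y)<\infty$ and $\sup_x\int\partial_\ell k(x,y)\,\mathrm d\mu(y)<\infty$ (the integrals being well defined), and $\partial_\ell\partial_{\ell+d}k$ exists and is continuous on $\mathbb R^d\times\mathbb R^d$; 2. $\partial_\ell\partial_r\partial_{r+d}\partial_{\ell+d}k$ exists and is continuous on $\mathbb R^d\times\mathbb R^d$, and the maps $x\mapsto k(x,x)$,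 $x\mapsto\partial_\ell\partial_{\ell+d}k(x,x)$, $x\mapsto\partial_\ell\partial_r\partial_{r+d}\partial_{\ell+d}k(x,x)$ are continuous and bounded in absolute value by $\kappa$. **Algorithm.** Let $\gamma>0$. Noisy MMD particle descent starts from given points $x^{(1)}_1,\dots,x^{(1)}_n\in\mathbb R^d$ and iterates, for $t\ge1$, $$x_i^{(t+1)}=x_i^{(t)}-\gamma\Big\{\tfrac1n\sum_{j=1}^n\nabla_1k\big(x_i^{(t)}+\beta_tu_i^{(t)},x_j^{(t)}\big)-\mathbb E_{Y\sim\mu}\big[\nabla_1k\big(x_i^{(t)}+\beta_tu_i^{(t)},Y\big)\big]\Big\},$$ where $u_1^{(t)},\dots,u_n^{(t)}$ are i.i.d. $\mathcal N(0,\mathrm I_d)$, independent of the past up to time $t$, and the noise level $\beta_t\in(0,1)$ is a function of that past (for instance, deterministic). Suppose that almost surely, for every $t\ge1$, $$\frac1n\sum_{i=1}^n\mathbb E_{u^{(t)}}\bigg[\Big\|\frac1n\sum_{j=1}^n\Phi\big(x_i^{(t)}+\beta_tu_i^{(t)},x_j^{(t)}\big)\Big\|^2\bigg]\ \ge\ 4\beta_t^2d^2\kappa^2\,\mathcal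 S(t)^2,\qquad \mathcal S(t)=\operatorname{MMD}\Big(\frac1n\sum_{i=1}^n\delta_{x_i^{(t)}},\mu\Big),$$ where $\mathbb E_{u^{(t)}}$ averages over the fresh noise only, with $x^{(t)}$ and $\beta_t$ fixed, and that $256\,\gamma^2d^2\kappa^2\le1$. **Theorem.** There is a constant $C>0$ depending only on $d$ and $\kappa$ (in particular not on $n$, $(\beta_t)$, $T$) such that for every integer $T\ge1$ and every $\delta>0$, with probability at least $1-e^{-\delta}$, $$\mathcal S(T)\le\exp\Big(-\frac{\kappa d^2}2\sum_{t=1}^{T-1}\gamma\beta_t^2\Big)\mathcal S(1)+\frac{\delta+\log T}{\sqrt n}\cdot C\sum_{t=1}^{T-1}\Big((\gamma\beta_t)^{1/2}\vee n^{-1/2}\Big)\exp\Big(-\frac{\kappa d^2}2\sum_{s=t+1}^{T-1}\gamma\beta_s^2\Big).$$ -/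

import Mathlib

open MeasureTheory ProbabilityTheory
open scoped ENNReal

noncomputable section

namespace MMDFlow

/-- The state space `ℝ^d` with its Euclidean norm. -/
abbrev Eu (d : ℕ) : Type := EuclideanSpace ℝ (Fin d)

/-- The `ℓ`-th coordinate vector of `ℝ^d`. -/
def basisVec {d : ℕ} (l : Fin d) : Eu d := EuclideanSpace.single l (1 : ℝ)

/-- `∂_ℓ f (x, y)`: partial derivative in the `ℓ`-th coordinate of the first argument. -/
def pd1 {d : ℕ} (l : Fin d) (f : Eu d → Eu d → ℝ) (x y : Eu d) : ℝ :=
  lineDeriv ℝ (fun z => f z y) x (basisVec l)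

/-- `∂_{ℓ+d} f (x, y)`: partial derivative in the `ℓ`-th coordinate of the second argument. -/
def pd2 {d : ℕ} (l : Fin d) (f : Eu d → Eu d → ℝ) (x y : Eu d) : ℝ :=
  lineDeriv ℝ (fun z => f x z) y (basisVec l)

/-- The partial derivative `∂_ℓ f` exists at every point. -/
def HasPd1 {d : ℕ} (l : Fin d) (f : Eu d → Eu d → ℝ) : Prop :=
  ∀ x y, LineDifferentiableAt ℝ (fun z => f z y) x (basisVec l)

/-- The partial derivative `∂_{ℓ+d} f` exists at every point. -/
def HasPd2 {d : ℕ} (l : Fin d) (f : Eu d → Eu d → ℝ) : Prop :=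
  ∀ x y, LineDifferentiableAt ℝ (fun z => f x z) y (basisVec l)

/-- `∇₁ k (x, y) = (∂_1 k (x, y), …, ∂_d k (x, y))`. -/
def grad1 {d : ℕ} (k : Eu d → Eu d → ℝ) (x y : Eu d) : Eu d :=
  WithLp.toLp 2 (fun l => pd1 l k x y)

/-- `k` is a (symmetric) positive semi-definite kernel: every Gram matrix
`(k (x_i, x_j))_{i,j}` of finitely many points is symmetric positive semi-definite. -/
def IsPSDKernel {d : ℕ} (k : Eu d → Eu d → ℝ) : Prop :=
  (Matrix.of k).PosSemidef

/-- `μ`-integrability and differentiability of the kernel. -/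
structure IntegrableDifferentiable {d : ℕ} (k : Eu d → Eu d → ℝ) (μ : Measure (Eu d)) :
    Prop where
  integrable : ∀ x, Integrable (fun y => k x y) μ
  bddAbove : BddAbove (Set.range fun x => ∫ y, k x y ∂μ)
  hasPd1 : ∀ l, HasPd1 l k
  integrable_pd1 : ∀ l x, Integrable (fun y => pd1 l k x y) μ
  bddAbove_pd1 : ∀ l, BddAbove (Set.range fun x => ∫ y, pd1 l k x y ∂μ)
  hasPd2 : ∀ l, HasPd2 l k
  hasPd12 : ∀ l, HasPd1 l (pd2 l k)
  continuous_pd12 : ∀ l, Continuous fun p : Eu d × Eu d => pd1 l (pd2 l k) p.1 p.2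

/-- Kernel regularity with constant `κ`: the kernel is twice continuously differentiable in the
usual sense for kernels (the mixed derivatives `∂_ℓ ∂_r ∂_{r+d} ∂_{ℓ+d} k` exist and are
continuous), and `k`, `∂_ℓ ∂_{ℓ+d} k`, `∂_ℓ ∂_r ∂_{r+d} ∂_{ℓ+d} k` are continuous on the diagonal
and bounded there by `κ`. -/
structure KernelRegularity {d : ℕ} (k : Eu d → Eu d → ℝ) (κ : ℝ) : Prop where
  continuous_diag : Continuous fun x => k x x
  bound : ∀ x, |k x x| ≤ κ
  continuous_diag_pd12 : ∀ l, Continuous fun x => pd1 l (pd2 l k) x x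
  bound_pd12 : ∀ l x, |pd1 l (pd2 l k) x x| ≤ κ
  hasPd22 : ∀ l r, HasPd2 r (pd2 l k)
  hasPd122 : ∀ l r, HasPd1 r (pd2 r (pd2 l k))
  hasPd1122 : ∀ l r, HasPd1 l (pd1 r (pd2 r (pd2 l k)))
  continuous_pd1122 : ∀ l r,
    Continuous fun p : Eu d × Eu d => pd1 l (pd1 r (pd2 r (pd2 l k))) p.1 p.2
  bound_pd1122 : ∀ l r x, |pd1 l (pd1 r (pd2 r (pd2 l k))) x x| ≤ κ

/-- The empirical measure `(1/n) ∑ i, δ_{x_i}`. -/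
def empirical {d n : ℕ} (x : Fin n → Eu d) : Measure (Eu d) :=
  (n : ℝ≥0∞)⁻¹ • ∑ i, Measure.dirac (x i)

/-- `MMD²(P, Q) = ∬ k(x, y) d(P - Q)(x) d(P - Q)(y)`, expanded by bilinearity and symmetry. -/
def mmdSq {d : ℕ} (k : Eu d → Eu d → ℝ) (P Q : Measure (Eu d)) : ℝ :=
  (∫ x, ∫ y, k x y ∂P ∂P) - 2 * (∫ x, ∫ y, k x y ∂Q ∂P) + ∫ x, ∫ y, k x y ∂Q ∂Q

/-- The maximum mean discrepancy. -/
def mmd {d : ℕ} (k : Eu d → Eu d → ℝ) (P Q : Measure (Eu d)) : ℝ :=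
  Real.sqrt (mmdSq k P Q)

/-- `Φ(z, w) = E_{Y ∼ μ} [∇₁ k (z, Y)] - ∇₁ k (z, w)`. -/
def Phi {d : ℕ} (k : Eu d → Eu d → ℝ) (μ : Measure (Eu d)) (z w : Eu d) : Eu d :=
  (∫ y, grad1 k z y ∂μ) - grad1 k z w

/-- The law of `n` i.i.d. standard Gaussian vectors of `ℝ^d`. -/
def gaussianNoise (d n : ℕ) : Measure (Fin n → Eu d) :=
  Measure.pi fun _ => stdGaussian (Eu d)

/-- The noise-level (gradient dominance) inequality at the particle configuration `x` for the
noise level `b`; the expectation is over the fresh noise only. -/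
def NoiseLevel {d n : ℕ} (k : Eu d → Eu d → ℝ) (μ : Measure (Eu d)) (κ b : ℝ)
    (x : Fin n → Eu d) : Prop :=
  4 * b ^ 2 * (d : ℝ) ^ 2 * κ ^ 2 * mmd k (empirical x) μ ^ 2 ≤
    (n : ℝ)⁻¹ * ∑ i, ∫ v : Fin n → Eu d,
      ‖(n : ℝ)⁻¹ • ∑ j, Phi k μ (x i + b • v i) (x j)‖ ^ 2 ∂(gaussianNoise d n)

/-- One step of noisy MMD particle descent with step size `γ`, noise level `b` and noise `v`. -/
def step {d n : ℕ} (k : Eu d → Eu d → ℝ) (μ : Measure (Eu d)) (γ b : ℝ)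
    (v x : Fin n → Eu d) : Fin n → Eu d := fun i =>
  x i - γ • ((n : ℝ)⁻¹ • (∑ j, grad1 k (x i + b • v i) (x j))
    - ∫ y, grad1 k (x i + b • v i) y ∂μ)

/-- `X` is a run of noisy MMD particle descent (times `1, 2, …`) started at `x₁`, driven by the
noise `u`. The noise `u t` is a family of `n` i.i.d. standard Gaussian vectors that is
independent of the past `ℱ t` and known at time `t + 1`; the noise level `β t` may be chosen on
the basis of the past `ℱ t` (a deterministic sequence being a special case). -/
structure IsNoisyDescent {d n : ℕ} {Ω : Type*} [mΩ : MeasurableSpace Ω] (Pr : Measure Ω)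
    (ℱ : Filtration ℕ mΩ) (k : Eu d → Eu d → ℝ) (μ : Measure (Eu d)) (γ : ℝ)
    (β : ℕ → Ω → ℝ) (u X : ℕ → Ω → Fin n → Eu d) (x₁ : Fin n → Eu d) : Prop where
  noise_measurable : ∀ t, 1 ≤ t → Measurable[ℱ (t + 1)] (u t)
  noise_law : ∀ t, 1 ≤ t → Pr.map (u t) = gaussianNoise d n
  noise_indep : ∀ t, 1 ≤ t → Indep (MeasurableSpace.comap (u t) inferInstance) (ℱ t) Pr
  level_measurable : ∀ t, 1 ≤ t → Measurable[ℱ t] (β t)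
  init : ∀ ω, X 1 ω = x₁
  update : ∀ t, 1 ≤ t → ∀ ω, X (t + 1) ω = step k μ γ (β t ω) (u t ω) (X t ω)

end MMDFlow

end

/-!
Let `φ` be a feature map of the kernel in a Hilbert space and let `m` be the difference of the mean
embeddings of the particles and of `μ`. Then the discrepancy is `‖m‖` (`IsSmoothFeature.mmd_eq`), and
a step of the algorithm moves each particle `x i` along `-γ G (x i + b v i)`, where `G` is the
gradient of the witness function `f = ⟪φ ·, m⟫` (`IsSmoothFeature.drift_eq`).

*Regularity.* The mixed derivatives of `k` are, by the mean value theorem, limits of Gram matrices of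
difference quotients of `φ`; so these quotients converge in norm, and `φ` is twice continuously
differentiable with derivatives of square norm at most `κ` (`exists_isSmoothFeature`). Hence the
entries of the Hessian of `f` are bounded by `√κ ‖m‖` (`IsSmoothFeature.hasBoundedHessian`).

*Descent.* A Taylor expansion bounds the increment of `‖m‖ ^ 2` by the average of terms
`stepEnergy G γ b (x i) (v i)` (`IsSmoothFeature.mmd_step_sq_le`), each depending on the noise of one
particle only. Their mean is controlled by `E‖G (x + b u) - G x‖ ^ 2 ≤ 2 (b d M) ^ 2`, where `M` bounds
the Hessian entries (`HasBoundedHessian.integral_norm_grad_sub_sq_le`). The naive Lipschitz estimate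
would give `d ^ 3` here in place of `d ^ 2`, which the noise level condition cannot absorb. The square
splits into a variance, treated coordinate by coordinate with an Efron-Stein argument
(`variance_pi_le_of_lipschitz`), and a squared bias, where the symmetry of the Hessian and the rotation
invariance of the Gaussian law allow the Hessian to be replaced by its trace
(`HasBoundedHessian.norm_integral_grad_sub_le`). With the noise level condition the mean of the
increment is at most `-κ d ^ 2 γ b ^ 2 ‖m‖ ^ 2` (`IsSmoothFeature.sum_integral_stepEnergy_le`).

*Fluctuations.* `stepEnergy` changes by at most a multiple of `γ b ‖m‖ ^ 2 ‖v‖` when the noise is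
switched on, so an exponential moment bound (`exists_concentration`) shows that the average deviates
from its mean by more than a multiple of `γ b ‖m‖ ^ 2 s / √n` with probability at most `exp (-s)`. The
factor `‖m‖ ^ 2` makes it possible to take square roots, which gives a linear recursion for the
discrepancy (`exists_step_bound`). With `s = δ + log T`, a union bound over the steps and
`le_of_recursive_contraction` finish the proof.
-/

namespace MMDFlow

open Filter Topology

/-! ### Feature maps and difference quotients -/

/-- A positive semi-definite kernel has a feature map into a real Hilbert space. -/
theorem IsPSDKernel.exists_featureMap {d : ℕ} {k : Eu d → Eu d → ℝ} (hk : IsPSDKernel k) :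
    ∃ (H : Type) (_ : NormedAddCommGroup H) (_ : InnerProductSpace ℝ H) (_ : CompleteSpace H)
      (φ : Eu d → H), ∀ x y, inner ℝ (φ x) (φ y) = k x y := by
  let K : Matrix (Eu d) (Eu d) (ℝ →L[ℝ] ℝ) :=
    Matrix.of fun x y => k x y • ContinuousLinearMap.id ℝ ℝ
  have hsymm : ∀ x y, k x y = k y x := fun x y => by
    have h := hk.1.apply y x
    simpa using h
  have hK : K.PosSemidef := by
    refine (RKHS.posSemidef_tfae.out 0 2 :
      K.PosSemidef ↔ K.IsHermitian ∧ ∀ vv : Eu d →₀ ℝ,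
        0 ≤ RCLike.re (vv.sum fun x w => vv.sum fun x' w' => inner ℝ (K x' x w) w')).mpr
      ⟨?_, fun vv => ?_⟩
    · ext x y
      have h1 : star (ContinuousLinearMap.id ℝ ℝ) = ContinuousLinearMap.id ℝ ℝ :=
        star_one (ℝ →L[ℝ] ℝ)
      simp [K, hsymm x y, h1]
    · have h := hk.2 vv
      rw [Finsupp.sum_comm] at h
      refine h.trans_eq ?_
      rw [RCLike.re_to_real]
      refine Finsupp.sum_congr fun x _ => Finsupp.sum_congr fun y _ => ?_
      have hKyx : K y x = k y x • ContinuousLinearMap.id ℝ ℝ := rfl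
      simp [hKyx]
      ring
  have : Fact K.PosSemidef := ⟨hK⟩
  refine ⟨RKHS.OfKernel K, inferInstance, inferInstance, inferInstance,
    fun x => RKHS.kerFun (RKHS.OfKernel K) x 1, fun x y => ?_⟩
  rw [← RKHS.kernel_inner, RKHS.OfKernel.kernel_ofKernel]
  simp [K, hsymm x y]

/-- The mean value theorem on the segment from `0` to `a`, whatever the sign of `a`. -/
theorem exists_sub_eq_mul_deriv {g g' : ℝ → ℝ} (hg : ∀ t, HasDerivAt g (g' t) t) (a : ℝ) :
    ∃ t, |t| ≤ |a| ∧ g a - g 0 = a * g' t := by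
  rcases lt_trichotomy a 0 with ha | rfl | ha
  · obtain ⟨t, ht, h⟩ := exists_hasDerivAt_eq_slope g g' ha
      (fun t _ => (hg t).continuousAt.continuousWithinAt) (fun t _ => hg t)
    refine ⟨t, by rw [abs_of_neg ha, abs_of_neg ht.2]; linarith [ht.1], ?_⟩
    rw [h]; field_simp; ring
  · exact ⟨0, by simp⟩
  · obtain ⟨t, ht, h⟩ := exists_hasDerivAt_eq_slope g g' ha
      (fun t _ => (hg t).continuousAt.continuousWithinAt) (fun t _ => hg t)
    refine ⟨t, by rw [abs_of_pos ha, abs_of_pos ht.1]; linarith [ht.2], ?_⟩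
    rw [h]; field_simp; ring

/-- A mixed second difference is a value of the mixed derivative taken in the order
"second variable first". -/
theorem exists_mixed_difference_eq {B B₁ B₁₂ : ℝ → ℝ → ℝ}
    (h₁ : ∀ h a, HasDerivAt (fun a => B h a) (B₁ h a) a)
    (h₁₂ : ∀ h a, HasDerivAt (fun h => B₁ h a) (B₁₂ h a) h) (h a : ℝ) :
    ∃ s t, |s| ≤ |h| ∧ |t| ≤ |a| ∧ B h a - B h 0 - B 0 a + B 0 0 = h * a * B₁₂ s t := by
  obtain ⟨t, ht, e⟩ := exists_sub_eq_mul_deriv (g := fun a => B h a - B 0 a)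
    (fun a => (h₁ h a).sub (h₁ 0 a)) a
  obtain ⟨s, hs, e'⟩ := exists_sub_eq_mul_deriv (g := fun h => B₁ h t) (fun h => h₁₂ h t) h
  refine ⟨s, t, hs, ht, ?_⟩
  rw [e'] at e
  linarith

/-- A family in a Hilbert space converges as soon as its Gram matrix does. -/
theorem exists_tendsto_of_tendsto_inner {H ι : Type*} [NormedAddCommGroup H]
    [InnerProductSpace ℝ H] [CompleteSpace H] {F : ι → H} {l : Filter ι} [l.NeBot] {c : ℝ}
    (hF : Tendsto (fun p : ι × ι => inner ℝ (F p.1) (F p.2)) (l ×ˢ l) (𝓝 c)) :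
    ∃ v, Tendsto F l (𝓝 v) := by
  have hdiag : Tendsto (fun i => inner ℝ (F i) (F i)) l (𝓝 c) :=
    hF.comp (tendsto_id.prodMk tendsto_id)
  have hsq : Tendsto (fun p : ι × ι => ‖F p.1 - F p.2‖ ^ 2) (l ×ˢ l) (𝓝 0) := by
    have h := ((hdiag.comp tendsto_fst).sub (hF.const_mul 2)).add
      (hdiag.comp (tendsto_snd (f := l) (g := l)))
    have e : c - 2 * c + c = 0 := by ring
    rw [e] at h
    refine h.congr fun p => ?_
    simp only [Function.comp_apply]
    rw [norm_sub_sq_real, real_inner_self_eq_norm_sq, real_inner_self_eq_norm_sq]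
  have hn : Tendsto (fun p : ι × ι => ‖F p.1 - F p.2‖) (l ×ˢ l) (𝓝 0) := by
    have h := hsq.sqrt
    simpa [Real.sqrt_sq (norm_nonneg _)] using h
  have hc : Cauchy (map F l) := by
    rw [cauchy_map_iff]
    refine ⟨inferInstance, ?_⟩
    rw [tendsto_uniformity_iff_dist_tendsto_zero]
    simpa [dist_eq_norm] using hn
  exact CompleteSpace.complete hc

/-- If a joint limit exists and the inner limits exist, the iterated limit is the joint one. -/
theorem tendsto_of_tendsto_prod {E α β : Type*} [PseudoMetricSpace E] {f : α × β → E} {g : α → E}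
    {la : Filter α} {lb : Filter β} [lb.NeBot] {v : E} (hf : Tendsto f (la ×ˢ lb) (𝓝 v))
    (hg : ∀ a, Tendsto (fun b => f (a, b)) lb (𝓝 (g a))) : Tendsto g la (𝓝 v) := by
  rw [Metric.tendsto_nhds]
  intro ε hε
  have h := (Metric.tendsto_nhds.1 hf (ε / 2) (half_pos hε)).curry
  filter_upwards [h] with a ha
  have := le_of_tendsto ((hg a).dist tendsto_const_nhds) (ha.mono fun b hb => hb.le)
  linarith

theorem hasDerivAt_comp_line {E F : Type*} [NormedAddCommGroup E] [NormedSpace ℝ E]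
    [NormedAddCommGroup F] [NormedSpace ℝ F] {f f' : E → F} {v : E}
    (hf : ∀ x, HasLineDerivAt ℝ f (f' x) x v) (x : E) (t : ℝ) :
    HasDerivAt (fun t : ℝ => f (x + t • v)) (f' (x + t • v)) t := by
  have h : HasDerivAt (fun s : ℝ => f (x + t • v + s • v)) (f' (x + t • v)) (t - t) := by
    rw [sub_self]; exact hf _
  have h2 := h.comp_sub_const t t
  refine h2.congr_of_eventuallyEq (Eventually.of_forall fun s => ?_)
  simp only
  congr 1
  module

theorem hasLineDerivAt_iff_tendsto {E F : Type*} [NormedAddCommGroup E] [NormedSpace ℝ E]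
    [NormedAddCommGroup F] [NormedSpace ℝ F] {f : E → F} {f' : F} {x v : E} :
    HasLineDerivAt ℝ f f' x v ↔
      Tendsto (fun t : ℝ => t⁻¹ • (f (x + t • v) - f x)) (𝓝[≠] 0) (𝓝 f') := by
  rw [HasLineDerivAt, hasDerivAt_iff_tendsto_slope_zero]
  simp

/-! ### Strong derivatives of the feature map -/

/-- Hilbert-valued families whose mutual inner products converge to a continuous kernel have
limits, which depend continuously on the parameter and realise that kernel. -/
theorem exists_limit_of_tendsto_gram {X H ι : Type*} [TopologicalSpace X] [NormedAddCommGroup H]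
    [InnerProductSpace ℝ H] [CompleteSpace H] {D : X → ι → H} {l : Filter ι} [l.NeBot]
    {q : X → X → ℝ} (hq : Continuous fun p : X × X => q p.1 p.2)
    (hD : ∀ x y, Tendsto (fun p : ι × ι => inner ℝ (D x p.1) (D y p.2)) (l ×ˢ l) (𝓝 (q x y))) :
    ∃ L : X → H, (∀ x, Tendsto (D x) l (𝓝 (L x))) ∧ Continuous L ∧
      ∀ x y, inner ℝ (L x) (L y) = q x y := by
  choose L hL using fun x => exists_tendsto_of_tendsto_inner (hD x x)
  have hin : ∀ x y, inner ℝ (L x) (L y) = q x y := fun x y =>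
    tendsto_nhds_unique
      (((hL x).comp tendsto_fst).inner ((hL y).comp (tendsto_snd (f := l) (g := l)))) (hD x y)
  refine ⟨L, hL, ?_, hin⟩
  rw [continuous_iff_continuousAt]
  intro x
  have hsq : Tendsto (fun y => ‖L y - L x‖ ^ 2) (𝓝 x) (𝓝 0) := by
    have e : ∀ y, ‖L y - L x‖ ^ 2 = q y y - 2 * q y x + q x x := fun y => by
      rw [norm_sub_sq_real, ← real_inner_self_eq_norm_sq, ← real_inner_self_eq_norm_sq, hin, hin,
        hin]
    have hc : Continuous fun y => q y y - 2 * q y x + q x x := by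
      have h1 : Continuous fun y => q y y := hq.comp (continuous_id.prodMk continuous_id)
      have h2 : Continuous fun y => q y x := hq.comp (continuous_id.prodMk continuous_const)
      exact (h1.sub (h2.const_mul 2)).add continuous_const
    have h := hc.tendsto x
    have e0 : q x x - 2 * q x x + q x x = 0 := by ring
    rw [e0] at h
    exact h.congr fun y => (e y).symm
  have hn : Tendsto (fun y => ‖L y - L x‖) (𝓝 x) (𝓝 0) := by
    simpa [Real.sqrt_sq (norm_nonneg _)] using hsq.sqrt
  exact tendsto_iff_norm_sub_tendsto_zero.2 hn

theorem HasPd1.hasDerivAt {d : ℕ} {l : Fin d} {f : Eu d → Eu d → ℝ} (hf : HasPd1 l f) (x y : Eu d)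
    (t : ℝ) : HasDerivAt (fun t : ℝ => f (x + t • basisVec l) y)
      (pd1 l f (x + t • basisVec l) y) t :=
  hasDerivAt_comp_line (f := fun z => f z y) (f' := fun z => pd1 l f z y)
    (fun z => (hf z y).hasLineDerivAt) x t

theorem HasPd2.hasDerivAt {d : ℕ} {l : Fin d} {f : Eu d → Eu d → ℝ} (hf : HasPd2 l f) (x y : Eu d)
    (t : ℝ) : HasDerivAt (fun t : ℝ => f x (y + t • basisVec l))
      (pd2 l f x (y + t • basisVec l)) t :=
  hasDerivAt_comp_line (f := fun z => f x z) (f' := fun z => pd2 l f x z)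
    (fun z => (hf x z).hasLineDerivAt) y t

section Feature

variable {d : ℕ} {k : Eu d → Eu d → ℝ} {H : Type*} [NormedAddCommGroup H] [InnerProductSpace ℝ H]
  {φ : Eu d → H}

/-- The first difference quotients of a feature map have inner products given by values of the
mixed derivative of the kernel at nearby points. -/
theorem exists_inner_difference_eq (hφ : ∀ x y, inner ℝ (φ x) (φ y) = k x y) {l : Fin d}
    (h2 : HasPd2 l k) (h12 : HasPd1 l (pd2 l k)) (x y : Eu d) (h a : ℝ) :
    ∃ s t, |s| ≤ |h| ∧ |t| ≤ |a| ∧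
      inner ℝ (φ (x + h • basisVec l) - φ x) (φ (y + a • basisVec l) - φ y) =
        h * a * pd1 l (pd2 l k) (x + s • basisVec l) (y + t • basisVec l) := by
  obtain ⟨s, t, hs, ht, e⟩ := exists_mixed_difference_eq
    (B := fun h a => k (x + h • basisVec l) (y + a • basisVec l))
    (fun h a => h2.hasDerivAt (x + h • basisVec l) y a)
    (fun h a => h12.hasDerivAt x (y + a • basisVec l) h) h a
  refine ⟨s, t, hs, ht, ?_⟩
  rw [← e]
  simp only [inner_sub_left, inner_sub_right, hφ, zero_smul, add_zero]
  ring

/-- Second differences: the four-fold mixed derivative of the kernel is reached by applying the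
mean value theorem first in the second argument, then in the first. -/
theorem exists_inner_secondDifference_eq (hφ : ∀ x y, inner ℝ (φ x) (φ y) = k x y) {l r : Fin d}
    (h2 : HasPd2 l k) (h22 : HasPd2 r (pd2 l k)) (h122 : HasPd1 r (pd2 r (pd2 l k)))
    (h1122 : HasPd1 l (pd1 r (pd2 r (pd2 l k)))) (x y : Eu d) (h a h' a' : ℝ) :
    ∃ s t s' t', |s| ≤ |h| ∧ |t| ≤ |a| ∧ |s'| ≤ |h'| ∧ |t'| ≤ |a'| ∧
      inner ℝ (φ (x + h • basisVec r + a • basisVec l) - φ (x + h • basisVec r)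
          - φ (x + a • basisVec l) + φ x)
        (φ (y + h' • basisVec r + a' • basisVec l) - φ (y + h' • basisVec r)
          - φ (y + a' • basisVec l) + φ y) =
        h * a * (h' * a') * pd1 l (pd1 r (pd2 r (pd2 l k)))
          (x + s • basisVec r + t • basisVec l) (y + s' • basisVec r + t' • basisVec l) := by
  have comm : ∀ (z : Eu d) (h a : ℝ), z + h • basisVec r + a • basisVec l
      = z + a • basisVec l + h • basisVec r := fun z h a => by abel
  let x₁ := x + h • basisVec r + a • basisVec l
  let x₂ := x + h • basisVec r
  let x₃ := x + a • basisVec l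
  obtain ⟨s', t', hs', ht', e'⟩ := exists_mixed_difference_eq
    (B := fun h' a' => k x₁ (y + h' • basisVec r + a' • basisVec l)
      - k x₂ (y + h' • basisVec r + a' • basisVec l)
      - k x₃ (y + h' • basisVec r + a' • basisVec l)
      + k x (y + h' • basisVec r + a' • basisVec l))
    (B₁ := fun h' a' => pd2 l k x₁ (y + h' • basisVec r + a' • basisVec l)
      - pd2 l k x₂ (y + h' • basisVec r + a' • basisVec l)
      - pd2 l k x₃ (y + h' • basisVec r + a' • basisVec l)
      + pd2 l k x (y + h' • basisVec r + a' • basisVec l))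
    (B₁₂ := fun h' a' => pd2 r (pd2 l k) x₁ (y + h' • basisVec r + a' • basisVec l)
      - pd2 r (pd2 l k) x₂ (y + h' • basisVec r + a' • basisVec l)
      - pd2 r (pd2 l k) x₃ (y + h' • basisVec r + a' • basisVec l)
      + pd2 r (pd2 l k) x (y + h' • basisVec r + a' • basisVec l))
    (fun h' a' => (((h2.hasDerivAt _ _ _).sub (h2.hasDerivAt _ _ _)).sub
      (h2.hasDerivAt _ _ _)).add (h2.hasDerivAt _ _ _))
    (fun h' a' => by
      simp only [comm y]
      exact (((h22.hasDerivAt _ _ _).sub (h22.hasDerivAt _ _ _)).sub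
        (h22.hasDerivAt _ _ _)).add (h22.hasDerivAt _ _ _)) h' a'
  set w := y + s' • basisVec r + t' • basisVec l
  obtain ⟨t, s, ht, hs, e⟩ := exists_mixed_difference_eq
    (B := fun a h => pd2 r (pd2 l k) (x + a • basisVec l + h • basisVec r) w)
    (fun a h => h122.hasDerivAt (x + a • basisVec l) w h)
    (fun a h => by
      simp only [← comm x]
      exact h1122.hasDerivAt (x + h • basisVec r) w a) a h
  refine ⟨s, t, s', t', hs, ht, hs', ht', ?_⟩
  simp only [← comm x, zero_smul, add_zero] at e e'
  have e2 : pd2 r (pd2 l k) x₁ w - pd2 r (pd2 l k) x₂ w - pd2 r (pd2 l k) x₃ w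
      + pd2 r (pd2 l k) x w
      = a * h * pd1 l (pd1 r (pd2 r (pd2 l k))) (x + s • basisVec r + t • basisVec l) w := by
    rw [← e]; ring
  rw [e2] at e'
  simp only [inner_sub_left, inner_sub_right, inner_add_left, inner_add_right, hφ]
  linear_combination e'

theorem tendsto_zero_of_abs_le {ι : Type*} {l : Filter ι} {f g : ι → ℝ} (h : ∀ i, |f i| ≤ |g i|)
    (hg : Tendsto g l (𝓝 0)) : Tendsto f l (𝓝 0) := by
  refine squeeze_zero_norm (a := fun i => |g i|) (fun i => h i) ?_
  simpa using hg.abs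

variable [CompleteSpace H]

/-- A feature map of a kernel with continuous mixed derivative `∂_ℓ ∂_{ℓ+d} k` has a strong partial
derivative in direction `ℓ`, whose kernel is that mixed derivative. -/
theorem exists_feature_deriv (hφ : ∀ x y, inner ℝ (φ x) (φ y) = k x y) {l : Fin d}
    (h2 : HasPd2 l k) (h12 : HasPd1 l (pd2 l k))
    (hc : Continuous fun p : Eu d × Eu d => pd1 l (pd2 l k) p.1 p.2) :
    ∃ ψ : Eu d → H, (∀ x, HasLineDerivAt ℝ φ (ψ x) x (basisVec l)) ∧
      ∀ x y, inner ℝ (ψ x) (ψ y) = pd1 l (pd2 l k) x y := by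
  obtain ⟨ψ, h1, -, h3⟩ := exists_limit_of_tendsto_gram (l := 𝓝[≠] (0 : ℝ))
    (D := fun x (t : ℝ) => t⁻¹ • (φ (x + t • basisVec l) - φ x)) hc fun x y => by
      choose s t hs ht e using exists_inner_difference_eq hφ h2 h12 x y
      have hid : Tendsto (fun t : ℝ => t) (𝓝[≠] 0) (𝓝 0) := nhdsWithin_le_nhds
      have ts : Tendsto (fun p : ℝ × ℝ => s p.1 p.2) (𝓝[≠] 0 ×ˢ 𝓝[≠] 0) (𝓝 0) :=
        tendsto_zero_of_abs_le (fun p => hs p.1 p.2) (hid.comp tendsto_fst)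
      have tt : Tendsto (fun p : ℝ × ℝ => t p.1 p.2) (𝓝[≠] 0 ×ˢ 𝓝[≠] 0) (𝓝 0) :=
        tendsto_zero_of_abs_le (fun p => ht p.1 p.2) (hid.comp tendsto_snd)
      have hcc : Continuous fun p : ℝ × ℝ =>
          pd1 l (pd2 l k) (x + p.1 • basisVec l) (y + p.2 • basisVec l) :=
        hc.comp (f := fun p : ℝ × ℝ => (x + p.1 • basisVec l, y + p.2 • basisVec l))
          (by fun_prop)
      have hlim := (hcc.tendsto (0, 0)).comp (ts.prodMk_nhds tt)
      simp only [zero_smul, add_zero] at hlim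
      refine hlim.congr' ?_
      have hne : ∀ᶠ p : ℝ × ℝ in 𝓝[≠] 0 ×ˢ 𝓝[≠] 0, p.1 ≠ 0 ∧ p.2 ≠ 0 :=
        (eventually_mem_nhdsWithin (a := (0 : ℝ)) (s := {0}ᶜ)).prod_mk
          (eventually_mem_nhdsWithin (a := (0 : ℝ)) (s := {0}ᶜ))
      filter_upwards [hne] with p hp
      obtain ⟨hp1, hp2⟩ := hp
      simp only [Function.comp_apply]
      rw [real_inner_smul_left, real_inner_smul_right, e]
      field_simp
  exact ⟨ψ, fun x => hasLineDerivAt_iff_tendsto.2 (h1 x), h3⟩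

/-- The mixed second difference quotients of a feature map converge jointly, so both iterated
limits exist and agree: this yields the mixed second partial derivative together with its
symmetry. -/
theorem exists_feature_deriv₂ (hφ : ∀ x y, inner ℝ (φ x) (φ y) = k x y) {l r : Fin d}
    (h2 : HasPd2 l k) (h22 : HasPd2 r (pd2 l k)) (h122 : HasPd1 r (pd2 r (pd2 l k)))
    (h1122 : HasPd1 l (pd1 r (pd2 r (pd2 l k))))
    (hc : Continuous fun p : Eu d × Eu d => pd1 l (pd1 r (pd2 r (pd2 l k))) p.1 p.2)
    {ψl ψr : Eu d → H} (hl : ∀ x, HasLineDerivAt ℝ φ (ψl x) x (basisVec l))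
    (hr : ∀ x, HasLineDerivAt ℝ φ (ψr x) x (basisVec r)) :
    ∃ χ : Eu d → H, (∀ x, HasLineDerivAt ℝ ψl (χ x) x (basisVec r)) ∧
      (∀ x, HasLineDerivAt ℝ ψr (χ x) x (basisVec l)) ∧ Continuous χ ∧
      ∀ x y, inner ℝ (χ x) (χ y) = pd1 l (pd1 r (pd2 r (pd2 l k))) x y := by
  let D : Eu d → ℝ × ℝ → H := fun x p => (p.1⁻¹ * p.2⁻¹) •
    (φ (x + p.1 • basisVec r + p.2 • basisVec l) - φ (x + p.1 • basisVec r)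
          - φ (x + p.2 • basisVec l) + φ x)
  have hid : Tendsto (fun t : ℝ => t) (𝓝[≠] 0) (𝓝 0) := nhdsWithin_le_nhds
  have hne : ∀ᶠ p : ℝ × ℝ in 𝓝[≠] 0 ×ˢ 𝓝[≠] 0, p.1 ≠ 0 ∧ p.2 ≠ 0 :=
    (eventually_mem_nhdsWithin (a := (0 : ℝ)) (s := {0}ᶜ)).prod_mk
      (eventually_mem_nhdsWithin (a := (0 : ℝ)) (s := {0}ᶜ))
  obtain ⟨χ, h1, hχ, h3⟩ := exists_limit_of_tendsto_gram
    (l := 𝓝[≠] (0 : ℝ) ×ˢ 𝓝[≠] (0 : ℝ)) (D := D) hc fun x y => by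
      choose s t s' t' hs ht hs' ht' e using
        exists_inner_secondDifference_eq hφ h2 h22 h122 h1122 x y
      let L : Filter ((ℝ × ℝ) × (ℝ × ℝ)) := (𝓝[≠] 0 ×ˢ 𝓝[≠] 0) ×ˢ (𝓝[≠] 0 ×ˢ 𝓝[≠] 0)
      have ts : Tendsto (fun p : (ℝ × ℝ) × (ℝ × ℝ) => s p.1.1 p.1.2 p.2.1 p.2.2) L (𝓝 0) :=
        tendsto_zero_of_abs_le (fun p => hs p.1.1 p.1.2 p.2.1 p.2.2)
          (hid.comp (tendsto_fst.comp tendsto_fst))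
      have tt : Tendsto (fun p : (ℝ × ℝ) × (ℝ × ℝ) => t p.1.1 p.1.2 p.2.1 p.2.2) L (𝓝 0) :=
        tendsto_zero_of_abs_le (fun p => ht p.1.1 p.1.2 p.2.1 p.2.2)
          (hid.comp (tendsto_snd.comp tendsto_fst))
      have ts' : Tendsto (fun p : (ℝ × ℝ) × (ℝ × ℝ) => s' p.1.1 p.1.2 p.2.1 p.2.2) L (𝓝 0) :=
        tendsto_zero_of_abs_le (fun p => hs' p.1.1 p.1.2 p.2.1 p.2.2)
          (hid.comp (tendsto_fst.comp tendsto_snd))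
      have tt' : Tendsto (fun p : (ℝ × ℝ) × (ℝ × ℝ) => t' p.1.1 p.1.2 p.2.1 p.2.2) L (𝓝 0) :=
        tendsto_zero_of_abs_le (fun p => ht' p.1.1 p.1.2 p.2.1 p.2.2)
          (hid.comp (tendsto_snd.comp tendsto_snd))
      have hcc : Continuous fun p : (ℝ × ℝ) × (ℝ × ℝ) =>
          pd1 l (pd1 r (pd2 r (pd2 l k))) (x + p.1.1 • basisVec r + p.1.2 • basisVec l)
            (y + p.2.1 • basisVec r + p.2.2 • basisVec l) :=
        hc.comp (f := fun p : (ℝ × ℝ) × (ℝ × ℝ) =>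
          (x + p.1.1 • basisVec r + p.1.2 • basisVec l,
            y + p.2.1 • basisVec r + p.2.2 • basisVec l)) (by fun_prop)
      have hlim := (hcc.tendsto ((0, 0), (0, 0))).comp
        ((ts.prodMk_nhds tt).prodMk_nhds (ts'.prodMk_nhds tt'))
      simp only [zero_smul, add_zero] at hlim
      refine hlim.congr' ?_
      filter_upwards [hne.prod_mk hne] with p hp
      obtain ⟨⟨hp1, hp2⟩, hp3, hp4⟩ := hp
      simp only [Function.comp_apply, D]
      rw [real_inner_smul_left, real_inner_smul_right, e]
      field_simp
  refine ⟨χ, fun x => hasLineDerivAt_iff_tendsto.2 ?_, fun x => hasLineDerivAt_iff_tendsto.2 ?_,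
    hχ, h3⟩
  · refine tendsto_of_tendsto_prod (h1 x) fun h => ?_
    have := ((hasLineDerivAt_iff_tendsto.1 (hl (x + h • basisVec r))).sub
      (hasLineDerivAt_iff_tendsto.1 (hl x))).const_smul h⁻¹
    refine this.congr fun a => ?_
    simp only [D]
    module
  · refine tendsto_of_tendsto_prod ((h1 x).comp tendsto_prod_swap) fun a => ?_
    have := ((hasLineDerivAt_iff_tendsto.1 (hr (x + a • basisVec l))).sub
      (hasLineDerivAt_iff_tendsto.1 (hr x))).const_smul a⁻¹
    refine this.congr fun h => ?_
    simp only [D, Function.comp_apply, Prod.fst_swap, Prod.snd_swap]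
    rw [add_right_comm x (a • basisVec l)]
    module

end Feature

/-! ### Functions with bounded Hessian -/

section Partial

variable {d : ℕ} {E : Type*} [NormedAddCommGroup E] [NormedSpace ℝ E]

/-- Mean value inequality along the coordinate axes: only the partial derivatives on the box
spanned by `x` and `x + h` enter. -/
theorem norm_add_sub_le_of_partial {F : Eu d → E} {F' : Fin d → Eu d → E}
    (hF : ∀ r x, HasLineDerivAt ℝ F (F' r x) x (basisVec r)) {C : ℝ} (x h : Eu d)
    (hC : ∀ z : Eu d, (∀ i, |z i - x i| ≤ |h i|) → ∀ r, ‖F' r z‖ ≤ C) :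
    ‖F (x + h) - F x‖ ≤ C * ∑ i, |h i| := by
  have key : ∀ s : Finset (Fin d), ‖F (x + ∑ i ∈ s, h i • basisVec i) - F x‖
      ≤ C * ∑ i ∈ s, |h i| := by
    intro s
    induction s using Finset.induction_on with
    | empty => simp
    | insert r s hr ih =>
      set z := x + ∑ i ∈ s, h i • basisVec i with hz
      have hzr : z r = x r := by
        have : (∑ i ∈ s, h i • basisVec i : Eu d) r = 0 := by
          rw [WithLp.ofLp_sum, Finset.sum_apply]
          refine Finset.sum_eq_zero fun i hi => ?_
          have : r ≠ i := fun h => hr (h ▸ hi)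
          simp [basisVec, this]
        rw [hz, PiLp.add_apply, this, add_zero]
      have hzi : ∀ i, i ≠ r → |z i - x i| ≤ |h i| := by
        intro i _
        have : (∑ j ∈ s, h j • basisVec j : Eu d) i = if i ∈ s then h i else 0 := by
          rw [WithLp.ofLp_sum, Finset.sum_apply]
          simp [basisVec]
        rw [hz, PiLp.add_apply, this, add_sub_cancel_left]
        split_ifs <;> simp
      have hline : ‖F (z + h r • basisVec r) - F (z + (0 : ℝ) • basisVec r)‖
          ≤ C * ‖h r - 0‖ := by
        refine (convex_uIcc (0 : ℝ) (h r)).norm_image_sub_le_of_norm_hasDerivWithin_le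
          (f := fun t : ℝ => F (z + t • basisVec r)) (f' := fun t => F' r (z + t • basisVec r))
          (fun t _ => (hasDerivAt_comp_line (hF r) z t).hasDerivWithinAt) (fun t ht => ?_)
          Set.left_mem_uIcc Set.right_mem_uIcc
        refine hC _ (fun i => ?_) r
        by_cases hi : i = r
        · subst hi
          have := Set.abs_sub_left_of_mem_uIcc ht
          simpa [hzr, basisVec] using this
        · simpa [basisVec, hi] using hzi i hi
      rw [Finset.sum_insert hr, Finset.sum_insert hr]
      have e : x + (h r • basisVec r + ∑ i ∈ s, h i • basisVec i) = z + h r • basisVec r := by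
        rw [hz]; abel
      rw [e]
      rw [zero_smul, add_zero, sub_zero, Real.norm_eq_abs] at hline
      calc ‖F (z + h r • basisVec r) - F x‖
          = ‖(F (z + h r • basisVec r) - F z) + (F z - F x)‖ := by rw [sub_add_sub_cancel]
        _ ≤ C * |h r| + C * ∑ i ∈ s, |h i| := (norm_add_le _ _).trans (add_le_add hline ih)
        _ = _ := by ring
  have hh : ∑ i, h i • basisVec i = h := by
    ext j
    rw [WithLp.ofLp_sum, Finset.sum_apply]
    simp [basisVec]
  simpa [hh] using key Finset.univ

theorem abs_apply_le_norm (h : Eu d) (i : Fin d) : |h i| ≤ ‖h‖ := by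
  simpa using PiLp.norm_apply_le h i

theorem sum_abs_sq_le (h : Eu d) : (∑ i, |h i|) ^ 2 ≤ d * ‖h‖ ^ 2 := by
  have := sq_sum_le_card_mul_sum_sq (s := Finset.univ) (f := fun i => |h i|)
  simpa [EuclideanSpace.real_norm_sq_eq] using this

/-- A map with continuous partial derivatives is Fréchet differentiable. -/
theorem hasFDerivAt_of_partial {F : Eu d → E} {F' : Fin d → Eu d → E}
    (hF : ∀ r x, HasLineDerivAt ℝ F (F' r x) x (basisVec r)) (hc : ∀ r, Continuous (F' r))
    (x : Eu d) :
    HasFDerivAt F (∑ r, (EuclideanSpace.proj r : Eu d →L[ℝ] ℝ).smulRight (F' r x)) x := by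
  set L : Eu d →L[ℝ] E := ∑ r, (EuclideanSpace.proj r : Eu d →L[ℝ] ℝ).smulRight (F' r x)
  have hL : ∀ r, L (basisVec r) = F' r x := by
    intro r
    simp [L, basisVec]
  rw [hasFDerivAt_iff_isLittleO_nhds_zero, Asymptotics.isLittleO_iff]
  intro c hc0
  have hev : ∀ᶠ z in 𝓝 x, ∀ r, ‖F' r z - F' r x‖ ≤ c / (d + 1) := by
    rw [eventually_all]
    intro r
    have := (hc r).tendsto x
    have h2 := (tendsto_iff_norm_sub_tendsto_zero.1 this).eventually
      (gt_mem_nhds (show (0 : ℝ) < c / (d + 1) by positivity))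
    exact h2.mono fun z hz => hz.le
  obtain ⟨δ, hδ, hball⟩ := Metric.eventually_nhds_iff.1 hev
  have hnear : ∀ᶠ h : Eu d in 𝓝 0, ‖h‖ < δ := by
    filter_upwards [Metric.ball_mem_nhds (0 : Eu d) hδ] with h hh
    simpa using hh
  filter_upwards [hnear] with h hh
  have hG : ∀ r z, HasLineDerivAt ℝ (fun z => F z - L z) (F' r z - F' r x) z (basisVec r) := by
    intro r z
    have h1 : HasLineDerivAt ℝ L (L (basisVec r)) z (basisVec r) :=
      L.hasFDerivAt.hasLineDerivAt _
    rw [hL] at h1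
    exact HasDerivAt.sub (hF r z) h1
  have key := norm_add_sub_le_of_partial hG (C := c / (d + 1)) x h (fun z hz r => by
    refine hball ?_ r
    refine lt_of_le_of_lt ?_ hh
    rw [dist_eq_norm, ← sq_le_sq₀ (norm_nonneg _) (norm_nonneg _),
      EuclideanSpace.real_norm_sq_eq, EuclideanSpace.real_norm_sq_eq]
    refine Finset.sum_le_sum fun i _ => ?_
    rw [PiLp.sub_apply]
    exact sq_le_sq.2 (hz i))
  have e : F (x + h) - F x - L h = F (x + h) - L (x + h) - (F x - L x) := by
    rw [map_add]; abel
  rw [e]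
  refine key.trans ?_
  have hsum : ∑ i, |h i| ≤ d * ‖h‖ := by
    calc ∑ i, |h i| ≤ ∑ _i : Fin d, ‖h‖ := Finset.sum_le_sum fun i _ => abs_apply_le_norm h i
      _ = d * ‖h‖ := by simp
  calc c / (d + 1) * ∑ i, |h i| ≤ c / (d + 1) * ((d + 1) * ‖h‖) := by
        gcongr
        refine hsum.trans ?_
        gcongr
        linarith
    _ = c * ‖h‖ := by field_simp

end Partial

/-- `f` is twice continuously differentiable with gradient `G` and Hessian entries `A r l`,
all bounded by `M`. -/
structure HasBoundedHessian {d : ℕ} (f : Eu d → ℝ) (G : Eu d → Eu d)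
    (A : Fin d → Fin d → Eu d → ℝ) (M : ℝ) : Prop where
  nonneg : 0 ≤ M
  hasLineDerivAt : ∀ l x, HasLineDerivAt ℝ f (G x l) x (basisVec l)
  hasLineDerivAt_grad : ∀ l r x, HasLineDerivAt ℝ (fun z => G z l) (A r l x) x (basisVec r)
  symm : ∀ l r x, A r l x = A l r x
  continuous : ∀ l r, Continuous (A r l)
  bound : ∀ l r x, |A r l x| ≤ M

namespace HasBoundedHessian

variable {d : ℕ} {f : Eu d → ℝ} {G : Eu d → Eu d} {A : Fin d → Fin d → Eu d → ℝ} {M : ℝ}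

theorem abs_grad_sub_le (hf : HasBoundedHessian f G A M) (l : Fin d) (x y : Eu d) :
    |G y l - G x l| ≤ M * ∑ i, |y i - x i| := by
  have := norm_add_sub_le_of_partial (F := fun z => G z l) (F' := fun r => A r l)
    (fun r => hf.hasLineDerivAt_grad l r) (C := M) x (y - x) (fun z _ r => hf.bound l r z)
  simpa using this

theorem norm_grad_sub_le (hf : HasBoundedHessian f G A M) (x y : Eu d) :
    ‖G y - G x‖ ≤ d * M * ‖y - x‖ := by
  have hM := hf.nonneg
  rw [← sq_le_sq₀ (norm_nonneg _) (by positivity), EuclideanSpace.real_norm_sq_eq]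
  calc ∑ l, (G y - G x) l ^ 2 ≤ ∑ _l : Fin d, M ^ 2 * (d * ‖y - x‖ ^ 2) := by
        refine Finset.sum_le_sum fun l _ => ?_
        have h1 := hf.abs_grad_sub_le l x y
        have h2 := sum_abs_sq_le (y - x)
        simp only [PiLp.sub_apply] at h2 ⊢
        calc (G y l - G x l) ^ 2 = |G y l - G x l| ^ 2 := (sq_abs _).symm
          _ ≤ (M * ∑ i, |y i - x i|) ^ 2 := by gcongr
          _ = M ^ 2 * (∑ i, |y i - x i|) ^ 2 := by ring
          _ ≤ _ := by gcongr
    _ = (d * M * ‖y - x‖) ^ 2 := by simp; ring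

theorem continuous_grad (hf : HasBoundedHessian f G A M) : Continuous G := by
  have : LipschitzWith (Real.toNNReal (d * M)) G := by
    refine LipschitzWith.of_dist_le' fun x y => ?_
    rw [dist_eq_norm, dist_eq_norm]
    exact hf.norm_grad_sub_le y x
  exact this.continuous

theorem hasDerivAt_line (hf : HasBoundedHessian f G A M) (x h : Eu d) (t : ℝ) :
    HasDerivAt (fun t : ℝ => f (x + t • h)) (inner ℝ (G (x + t • h)) h) t := by
  have h1 := fun z => (hasFDerivAt_of_partial hf.hasLineDerivAt (fun r =>
    ((EuclideanSpace.proj r : Eu d →L[ℝ] ℝ).continuous.comp hf.continuous_grad)) z).hasLineDerivAt h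
  have h2 := hasDerivAt_comp_line h1 x t
  refine h2.congr_deriv ?_
  simp [PiLp.inner_apply]

theorem hasFDerivAt_grad (hf : HasBoundedHessian f G A M) (l : Fin d) (x : Eu d) :
    HasFDerivAt (fun z => G z l)
      (∑ r, (EuclideanSpace.proj r : Eu d →L[ℝ] ℝ).smulRight (A r l x)) x :=
  hasFDerivAt_of_partial (hf.hasLineDerivAt_grad l) (fun r => hf.continuous l r) x

/-- Second order Taylor bound. -/
theorem le_taylor (hf : HasBoundedHessian f G A M) (x h : Eu d) :
    f (x + h) ≤ f x + inner ℝ (G x) h + d * M / 2 * ‖h‖ ^ 2 := by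
  let g : ℝ → ℝ := fun t => f (x + t • h) - t * inner ℝ (G x) h - d * M / 2 * ‖h‖ ^ 2 * t ^ 2
  have hg : ∀ t, HasDerivAt g (inner ℝ (G (x + t • h)) h - inner ℝ (G x) h
      - d * M / 2 * ‖h‖ ^ 2 * (2 * t)) t := by
    intro t
    have h1 := (hasDerivAt_id t).mul_const (inner ℝ (G x) h)
    have h2 := (hasDerivAt_pow 2 t).const_mul (d * M / 2 * ‖h‖ ^ 2)
    refine (((hf.hasDerivAt_line x h t).sub h1).sub h2).congr_deriv ?_
    simp
  have hanti : AntitoneOn g (Set.Icc 0 1) := by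
    refine antitoneOn_of_deriv_nonpos (convex_Icc 0 1)
      (fun t _ => (hg t).continuousAt.continuousWithinAt)
      (fun t _ => (hg t).differentiableAt.differentiableWithinAt) fun t ht => ?_
    rw [interior_Icc] at ht
    rw [(hg t).deriv, ← inner_sub_left]
    have h1 := real_inner_le_norm (G (x + t • h) - G x) h
    have h2 := hf.norm_grad_sub_le x (x + t • h)
    rw [add_sub_cancel_left, norm_smul, Real.norm_eq_abs, abs_of_pos ht.1] at h2
    have h3 := mul_le_mul_of_nonneg_right h2 (norm_nonneg h)
    nlinarith
  have h01 := hanti (Set.left_mem_Icc.2 zero_le_one) (Set.right_mem_Icc.2 zero_le_one) zero_le_one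
  simp only [g, one_smul, zero_smul, add_zero] at h01
  linarith

end HasBoundedHessian

/-! ### Gaussian integrals -/

section

theorem integral_sq_sub_sq_integral_le {α : Type*} [MeasurableSpace α] {ν : Measure α}
    [IsProbabilityMeasure ν] {h : α → ℝ} (h1 : Integrable h ν) (h2 : Integrable (fun a => h a ^ 2) ν)
    (c : ℝ) : ∫ a, h a ^ 2 ∂ν - (∫ a, h a ∂ν) ^ 2 ≤ ∫ a, (h a - c) ^ 2 ∂ν := by
  have e : ∫ a, (h a - c) ^ 2 ∂ν = ∫ a, h a ^ 2 ∂ν - 2 * c * ∫ a, h a ∂ν + c ^ 2 := by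
    have : (fun a => (h a - c) ^ 2) = fun a => h a ^ 2 - 2 * c * h a + c ^ 2 := by
      ext a; ring
    have h3 : Integrable (fun a => h a ^ 2 - 2 * c * h a) ν := h2.sub (h1.const_mul _)
    rw [this, integral_add h3 (integrable_const _), integral_sub h2 (h1.const_mul _),
      integral_const_mul]
    simp
  rw [e]
  nlinarith [sq_nonneg (∫ a, h a ∂ν - c)]

/-- Efron-Stein bound: under a product of laws with second moment at most one, a function that is
`M`-Lipschitz for the `ℓ¹` norm has variance at most `d * M ^ 2`. -/
theorem variance_pi_le_of_lipschitz {ν : Measure ℝ} [IsProbabilityMeasure ν]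
    (hν : Integrable (fun y => y ^ 2) ν) (hν1 : ∫ y, y ^ 2 ∂ν ≤ 1) {M B : ℝ} :
    ∀ {d : ℕ} {F : (Fin d → ℝ) → ℝ}, Continuous F → (∀ y, |F y| ≤ B) →
      (∀ y z, |F y - F z| ≤ M * ∑ i, |y i - z i|) →
      ∫ y, F y ^ 2 ∂(Measure.pi fun _ => ν) - (∫ y, F y ∂(Measure.pi fun _ => ν)) ^ 2
        ≤ d * M ^ 2 := by
  intro d
  induction d with
  | zero =>
    intro F _ _ _
    have : F = fun _ => F default := by ext y; rw [Subsingleton.elim y default]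
    rw [this]
    simp
  | succ d ih =>
    intro F hFc hFB hFL
    set π : Measure (Fin d → ℝ) := Measure.pi fun _ => ν with hπ
    let e := MeasurableEquiv.piFinSuccAbove (fun _ : Fin (d + 1) => ℝ) 0
    have hcons : ∀ p : ℝ × (Fin d → ℝ), e.symm p = Fin.cons p.1 p.2 := fun p => by
      simp only [e, MeasurableEquiv.piFinSuccAbove_symm_apply, Fin.insertNthEquiv_zero]
      rfl
    have hmp : MeasurePreserving e.symm (ν.prod π) (Measure.pi fun _ : Fin (d + 1) => ν) :=
      (measurePreserving_piFinSuccAbove (fun _ : Fin (d + 1) => ν) 0).symm e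
    have hint : ∀ g : (Fin (d + 1) → ℝ) → ℝ, Continuous g → (∃ b, ∀ y, |g y| ≤ b) →
        ∫ y, g y ∂(Measure.pi fun _ => ν) = ∫ a, ∫ y, g (Fin.cons a y) ∂π ∂ν := by
      intro g hg ⟨b, hb⟩
      rw [← hmp.integral_comp e.symm.measurableEmbedding g]
      simp_rw [hcons]
      refine integral_prod _ ?_
      refine Integrable.of_bound (C := b) ?_ (ae_of_all _ fun p => hb _)
      exact (hg.comp (f := fun p : ℝ × (Fin d → ℝ) => (Fin.cons p.1 p.2 : Fin (d + 1) → ℝ))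
        (by fun_prop)).aestronglyMeasurable
    have hsqB : ∀ y, |F y ^ 2| ≤ B ^ 2 := fun y => by
      rw [abs_pow]; exact pow_le_pow_left₀ (abs_nonneg _) (hFB y) 2
    have hcc : ∀ a, Continuous fun y : Fin d → ℝ => F (Fin.cons a y) := fun a =>
      hFc.comp (f := fun y : Fin d → ℝ => (Fin.cons a y : Fin (d + 1) → ℝ)) (by fun_prop)
    have hiF : ∀ a, Integrable (fun y => F (Fin.cons a y)) π := fun a =>
      Integrable.of_bound (hcc a).aestronglyMeasurable B (ae_of_all _ fun y => hFB _)
    let h : ℝ → ℝ := fun a => ∫ y, F (Fin.cons a y) ∂π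
    have hhL : ∀ a b, |h a - h b| ≤ M * |a - b| := by
      intro a b
      simp only [h]
      rw [← integral_sub (hiF a) (hiF b)]
      have := norm_integral_le_of_norm_le_const (μ := π) (C := M * |a - b|)
        (f := fun y => F (Fin.cons a y) - F (Fin.cons b y)) (ae_of_all _ fun y => by
          have := hFL (Fin.cons a y) (Fin.cons b y)
          simpa [Fin.sum_univ_succ] using this)
      simpa using this
    have hhc : Continuous h := by
      have : LipschitzWith (Real.toNNReal M) h := LipschitzWith.of_dist_le' fun a b => hhL a b
      exact this.continuous
    have hhB : ∀ a, |h a| ≤ B := fun a => by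
      have := norm_integral_le_of_norm_le_const (μ := π) (C := B)
        (f := fun y => F (Fin.cons a y)) (ae_of_all _ fun y => hFB _)
      simpa using this
    have hh1 : Integrable h ν :=
      Integrable.of_bound hhc.aestronglyMeasurable B (ae_of_all _ fun y => hhB _)
    have hh2 : Integrable (fun a => h a ^ 2) ν :=
      Integrable.of_bound (hhc.pow 2).aestronglyMeasurable (B ^ 2) (ae_of_all _ fun y => by
        rw [norm_pow]; exact pow_le_pow_left₀ (abs_nonneg _) (hhB y) 2)
    rw [hint F hFc ⟨B, hFB⟩, hint (fun y => F y ^ 2) (hFc.pow 2) ⟨B ^ 2, hsqB⟩]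
    -- condition on the first coordinate `a`: the inner variance is bounded by induction, and the
    -- conditional mean `h` is again `M`-Lipschitz
    have hinner : ∀ a, ∫ y, F (Fin.cons a y) ^ 2 ∂π ≤ d * M ^ 2 + h a ^ 2 := by
      intro a
      have := ih (F := fun y => F (Fin.cons a y)) (hcc a) (fun y => hFB _) fun y z => by
        have := hFL (Fin.cons a y) (Fin.cons a z)
        simpa [Fin.sum_univ_succ] using this
      simp only [h]
      linarith
    have h3 : ∫ a, ∫ y, F (Fin.cons a y) ^ 2 ∂π ∂ν ≤ ∫ a, (d * M ^ 2 + h a ^ 2) ∂ν :=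
      integral_mono_of_nonneg (ae_of_all _ fun a => integral_nonneg fun y => sq_nonneg _)
        ((integrable_const _).add hh2) (ae_of_all _ hinner)
    rw [integral_add (integrable_const _) hh2] at h3
    have h4 := integral_sq_sub_sq_integral_le hh1 hh2 (h 0)
    have h5 : ∫ a, (h a - h 0) ^ 2 ∂ν ≤ ∫ a, M ^ 2 * a ^ 2 ∂ν := by
      refine integral_mono_of_nonneg (ae_of_all _ fun a => sq_nonneg _) (hν.const_mul _)
        (ae_of_all _ fun a => ?_)
      have := pow_le_pow_left₀ (abs_nonneg _) (hhL a 0) 2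
      simpa [mul_pow] using this
    rw [integral_const_mul] at h5
    have h6 : M ^ 2 * ∫ a, a ^ 2 ∂ν ≤ M ^ 2 * 1 := by gcongr
    simp only [integral_const, probReal_univ, one_smul] at h3
    push_cast
    simp only [h] at h3 h4 h5
    linarith

variable {d : ℕ}

theorem integrable_norm_stdGaussian : Integrable (fun u : Eu d => ‖u‖) (stdGaussian (Eu d)) :=
  IsGaussian.integrable_id.norm

theorem integral_inner_sq_stdGaussian (v : Eu d) :
    ∫ u, (inner ℝ v u) ^ 2 ∂(stdGaussian (Eu d)) = ‖v‖ ^ 2 := by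
  have h := variance_dual_stdGaussian (innerSL ℝ v : StrongDual ℝ (Eu d))
  rw [variance_of_integral_eq_zero (by fun_prop) (integral_strongDual_stdGaussian _)] at h
  simpa using h

theorem integrable_inner_sq_stdGaussian (v : Eu d) :
    Integrable (fun u => (inner ℝ v u) ^ 2) (stdGaussian (Eu d)) := by
  have h : MemLp (fun u : Eu d => inner ℝ v u) 2 (stdGaussian (Eu d)) := by
    have := (innerSL ℝ v : StrongDual ℝ (Eu d)).comp_memLp'
      (IsGaussian.memLp_two_id (μ := stdGaussian (Eu d)))
    exact this
  exact h.integrable_sq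

theorem integral_abs_inner_stdGaussian_le (v : Eu d) :
    ∫ u, |inner ℝ v u| ∂(stdGaussian (Eu d)) ≤ ‖v‖ := by
  rcases eq_or_ne v 0 with rfl | hv
  · simp
  have hv' : 0 < ‖v‖ := norm_pos_iff.2 hv
  have hb : Integrable (fun u : Eu d => (‖v‖)⁻¹ / 2 * (inner ℝ v u) ^ 2 + ‖v‖ / 2)
      (stdGaussian (Eu d)) :=
    ((integrable_inner_sq_stdGaussian v).const_mul _).add (integrable_const _)
  have h : ∫ u, |inner ℝ v u| ∂(stdGaussian (Eu d))
      ≤ ∫ u, ((‖v‖)⁻¹ / 2 * (inner ℝ v u) ^ 2 + ‖v‖ / 2) ∂(stdGaussian (Eu d)) := by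
    refine integral_mono_of_nonneg (ae_of_all _ fun u => abs_nonneg _) hb (ae_of_all _ fun u => ?_)
    have h1 : 0 ≤ (|inner ℝ v u| - ‖v‖) ^ 2 / (2 * ‖v‖) := by positivity
    have h2 : (|inner ℝ v u| - ‖v‖) ^ 2 / (2 * ‖v‖)
        = (‖v‖)⁻¹ / 2 * (inner ℝ v u) ^ 2 + ‖v‖ / 2 - |inner ℝ v u| := by
      rw [← sq_abs (inner ℝ v u)]
      field_simp
      ring
    simp only
    linarith
  rw [integral_add ((integrable_inner_sq_stdGaussian v).const_mul _) (integrable_const _),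
    integral_const_mul, integral_inner_sq_stdGaussian] at h
  refine h.trans (le_of_eq ?_)
  simp
  field_simp
  ring

/-- Differentiation under a Gaussian integral along a curve of speed at most `K * ‖u‖`. -/
theorem hasDerivAt_integral_stdGaussian {g : Eu d → ℝ} {g' : Fin d → Eu d → ℝ} {M B K : ℝ}
    (hM : 0 ≤ M)
    (hg : ∀ r x, HasLineDerivAt ℝ g (g' r x) x (basisVec r)) (hgc : ∀ r, Continuous (g' r))
    (hgM : ∀ r x, |g' r x| ≤ M) (hgB : ∀ x, |g x| ≤ B) {c c' : ℝ → Eu d → Eu d}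
    (hc : ∀ θ u, HasDerivAt (fun θ => c θ u) (c' θ u) θ) (hcc : ∀ θ, Continuous (c θ))
    (hcc' : ∀ θ, Continuous (c' θ)) (hK : ∀ θ u, ‖c' θ u‖ ≤ K * ‖u‖) (θ : ℝ) :
    HasDerivAt (fun θ => ∫ u, g (c θ u) ∂(stdGaussian (Eu d)))
      (∫ u, ∑ i, g' i (c θ u) * c' θ u i ∂(stdGaussian (Eu d))) θ := by
  have hd := hasFDerivAt_of_partial hg hgc
  have hgcont : Continuous g := continuous_iff_continuousAt.2 fun x => (hd x).continuousAt
  refine (hasDerivAt_integral_of_dominated_loc_of_deriv_le (s := Set.univ)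
    (F := fun θ u => g (c θ u)) (F' := fun θ u => ∑ i, g' i (c θ u) * c' θ u i)
    (bound := fun u => d * (M * (K * ‖u‖))) univ_mem
    (Eventually.of_forall fun θ => (hgcont.comp (hcc θ)).aestronglyMeasurable)
    (Integrable.of_bound (hgcont.comp (hcc θ)).aestronglyMeasurable B (ae_of_all _ fun u => hgB _))
    ?_ (ae_of_all _ fun u θ _ => ?_) ?_ (ae_of_all _ fun u θ _ => ?_)).2
  · refine Continuous.aestronglyMeasurable ?_
    refine continuous_finsetSum _ fun i _ => ?_
    exact ((hgc i).comp (hcc θ)).mul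
      ((EuclideanSpace.proj i : Eu d →L[ℝ] ℝ).continuous.comp (hcc' θ))
  · rw [Real.norm_eq_abs]
    calc |∑ i, g' i (c θ u) * c' θ u i| ≤ ∑ i, |g' i (c θ u) * c' θ u i| :=
          Finset.abs_sum_le_sum_abs _ _
      _ ≤ ∑ _i : Fin d, M * (K * ‖u‖) := by
          refine Finset.sum_le_sum fun i _ => ?_
          rw [abs_mul]
          exact mul_le_mul (hgM i _) ((abs_apply_le_norm _ i).trans (hK θ u)) (abs_nonneg _) hM
      _ = d * (M * (K * ‖u‖)) := by simp
  · exact ((integrable_norm_stdGaussian.const_mul K).const_mul M).const_mul _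
  · refine ((hd (c θ u)).comp_hasDerivAt θ (hc θ u)).congr_deriv ?_
    simp [mul_comm]

end

/-! ### Mean square change of a gradient under Gaussian noise -/

section

variable {d : ℕ}

/-- The rotation by the angle `θ` in the plane of two coordinate axes. -/
theorem exists_planeRotation {l r : Fin d} (hlr : l ≠ r) (θ : ℝ) :
    ∃ R : Eu d ≃ₗᵢ[ℝ] Eu d, ∀ u, R u = u
      + ((Real.cos θ - 1) * u l + Real.sin θ * u r) • basisVec l
      + ((Real.cos θ - 1) * u r - Real.sin θ * u l) • basisVec r := by
  let R₀ : Eu d →ₗ[ℝ] Eu d :=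
    { toFun := fun u => u + ((Real.cos θ - 1) * u l + Real.sin θ * u r) • basisVec l
        + ((Real.cos θ - 1) * u r - Real.sin θ * u l) • basisVec r
      map_add' := fun u v => by
        simp only [PiLp.add_apply]
        module
      map_smul' := fun c u => by
        simp only [PiLp.smul_apply, smul_eq_mul, RingHom.id_apply]
        module }
  have hR : ∀ u, ‖R₀ u‖ = ‖u‖ := by
    intro u
    have hl : ∀ (w : Eu d) (a : ℝ) (i : Fin d),
        ‖w + a • basisVec i‖ ^ 2 = ‖w‖ ^ 2 + 2 * a * w i + a ^ 2 := by
      intro w a i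
      rw [norm_add_sq_real, real_inner_smul_right, norm_smul]
      simp [basisVec, EuclideanSpace.inner_single_right]
      ring
    have hrl : r ≠ l := hlr.symm
    rw [← sq_eq_sq₀ (norm_nonneg _) (norm_nonneg _)]
    change ‖u + ((Real.cos θ - 1) * u l + Real.sin θ * u r) • basisVec l
        + ((Real.cos θ - 1) * u r - Real.sin θ * u l) • basisVec r‖ ^ 2 = _
    rw [hl, hl]
    have h0 : (basisVec l : Eu d) r = 0 := by simp [basisVec, hrl]
    rw [PiLp.add_apply, PiLp.smul_apply, h0]
    simp only [smul_eq_mul, mul_zero, add_zero]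
    have hsc := Real.sin_sq_add_cos_sq θ
    linear_combination (u l ^ 2 + u r ^ 2) * hsc
  exact ⟨(⟨R₀, hR⟩ : Eu d →ₗᵢ[ℝ] Eu d).toLinearIsometryEquiv rfl, fun u => rfl⟩

/-- Infinitesimal rotation invariance of the standard Gaussian law: the derivative of `g` along
the rotation field of a coordinate plane has mean zero. -/
theorem integral_partial_mul_comm {g : Eu d → ℝ} {g' : Fin d → Eu d → ℝ} {M B : ℝ} (hM : 0 ≤ M)
    (hg : ∀ r x, HasLineDerivAt ℝ g (g' r x) x (basisVec r)) (hgc : ∀ r, Continuous (g' r))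
    (hgM : ∀ r x, |g' r x| ≤ M) (hgB : ∀ x, |g x| ≤ B) (l r : Fin d) :
    ∫ u, g' l u * u r ∂(stdGaussian (Eu d)) = ∫ u, g' r u * u l ∂(stdGaussian (Eu d)) := by
  rcases eq_or_ne l r with rfl | hlr
  · rfl
  have hcoord : ∀ i : Fin d, Continuous fun u : Eu d => u i := fun i =>
    (EuclideanSpace.proj i : Eu d →L[ℝ] ℝ).continuous
  have hint : ∀ i j, Integrable (fun u : Eu d => g' i u * u j) (stdGaussian (Eu d)) := by
    intro i j
    refine (integrable_norm_stdGaussian.const_mul M).mono'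
      ((hgc i).mul (hcoord j)).aestronglyMeasurable (ae_of_all _ fun u => ?_)
    rw [norm_mul]
    exact mul_le_mul (hgM i u) (abs_apply_le_norm u j) (abs_nonneg _) hM
  choose R hR using exists_planeRotation hlr
  have hconst : ∀ θ, ∫ u, g (R θ u) ∂(stdGaussian (Eu d)) = ∫ u, g u ∂(stdGaussian (Eu d)) := by
    intro θ
    have hmap := stdGaussian_map (R θ)
    have h2 := (R θ).toHomeomorph.toMeasurableEquiv.measurableEmbedding.integral_map
      (μ := stdGaussian (Eu d)) g
    have e : ⇑(R θ).toHomeomorph.toMeasurableEquiv = ⇑(R θ) := rfl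
    rw [e, hmap] at h2
    exact h2.symm
  let c' : ℝ → Eu d → Eu d := fun θ u =>
    (-Real.sin θ * u l + Real.cos θ * u r) • basisVec l
      + (-Real.sin θ * u r - Real.cos θ * u l) • basisVec r
  have hnb : ∀ i : Fin d, ‖(basisVec i : Eu d)‖ = 1 := fun i => by simp [basisVec]
  have hderiv := hasDerivAt_integral_stdGaussian hM hg hgc hgM hgB (c := fun θ u => R θ u)
    (c' := c') (K := 4) (fun θ u => by
      simp only [hR, c']
      have hs := Real.hasDerivAt_sin θ
      have hcos := Real.hasDerivAt_cos θ
      have h1 := (((hcos.sub_const 1).mul_const (u l)).add (hs.mul_const (u r))).smul_const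
        (basisVec l : Eu d)
      have h2 := (((hcos.sub_const 1).mul_const (u r)).sub (hs.mul_const (u l))).smul_const
        (basisVec r : Eu d)
      have h3 := (h1.const_add u).add h2
      exact h3)
    (fun θ => (R θ).continuous)
    (fun θ => by
      have h1 := hcoord l
      have h2 := hcoord r
      simp only [c']
      fun_prop)
    (fun θ u => by
      have h1 := abs_apply_le_norm u l
      have h2 := abs_apply_le_norm u r
      have h3 := Real.abs_sin_le_one θ
      have h4 := Real.abs_cos_le_one θ
      have hm : ∀ a b : ℝ, |a| ≤ 1 → |b| ≤ ‖u‖ → |a * b| ≤ ‖u‖ := fun a b ha hb => by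
        rw [abs_mul]
        calc |a| * |b| ≤ 1 * ‖u‖ := mul_le_mul ha hb (abs_nonneg _) zero_le_one
          _ = ‖u‖ := one_mul _
      have h3' : |-Real.sin θ| ≤ 1 := by rwa [abs_neg]
      have p1 := abs_add_le (-Real.sin θ * u l) (Real.cos θ * u r)
      have p2 := abs_sub (-Real.sin θ * u r) (Real.cos θ * u l)
      have q1 := hm _ _ h3' h1
      have q2 := hm _ _ h4 h2
      have q3 := hm _ _ h3' h2
      have q4 := hm _ _ h4 h1
      refine (norm_add_le _ _).trans ?_
      rw [norm_smul, norm_smul, hnb, hnb, Real.norm_eq_abs, Real.norm_eq_abs]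
      linarith) 0
  have hz : HasDerivAt (fun θ => ∫ u, g (R θ u) ∂(stdGaussian (Eu d))) 0 0 := by
    simp only [hconst]
    exact hasDerivAt_const _ _
  have hval := hderiv.unique hz
  have hR0 : ∀ u, R 0 u = u := fun u => by rw [hR]; simp
  have hsum : ∀ u : Eu d, ∑ i, g' i (R 0 u) * c' 0 u i = g' l u * u r - g' r u * u l := by
    intro u
    simp only [hR0, c', Real.sin_zero, Real.cos_zero]
    simp [basisVec, ← sub_eq_add_neg, mul_sub]
  simp only [hsum] at hval
  rw [integral_sub (hint l r) (hint r l)] at hval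
  linarith

namespace HasBoundedHessian

variable {f : Eu d → ℝ} {G : Eu d → Eu d} {A : Fin d → Fin d → Eu d → ℝ} {M B : ℝ}

/-- The Gaussian average of the gradient moves by at most `b * d * M` when the noise level goes
from `0` to `b`. The symmetry of the Hessian turns the derivative in the noise level, tested
against `v`, into the mean of `tr A * ⟪v, u⟫`; this is what saves a factor `√d`. -/
theorem norm_integral_grad_sub_le (hf : HasBoundedHessian f G A M) (hB : ∀ x, ‖G x‖ ≤ B) (x : Eu d)
    {b : ℝ} (hb : 0 < b) {w : Eu d}
    (hw : ∀ l, w l = ∫ u, G (x + b • u) l ∂(stdGaussian (Eu d)) - G x l) :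
    ‖w‖ ≤ b * (d * M) := by
  have hM := hf.nonneg
  have hcoord : ∀ i : Fin d, Continuous fun u : Eu d => u i := fun i =>
    (EuclideanSpace.proj i : Eu d →L[ℝ] ℝ).continuous
  have hline : ∀ s : ℝ, Continuous fun u : Eu d => x + s • u := fun s => by fun_prop
  have hGB : ∀ l z, |G z l| ≤ B := fun l z => (abs_apply_le_norm _ l).trans (hB z)
  have hint : ∀ (i j k : Fin d) (s : ℝ), Integrable (fun u : Eu d => A i j (x + s • u) * u k)
      (stdGaussian (Eu d)) := by
    intro i j k s
    refine (integrable_norm_stdGaussian.const_mul M).mono'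
      (((hf.continuous j i).comp (hline s)).mul (hcoord k)).aestronglyMeasurable
      (ae_of_all _ fun u => ?_)
    rw [norm_mul]
    exact mul_le_mul (hf.bound j i _) (abs_apply_le_norm u k) (abs_nonneg _) hM
  let P : ℝ → ℝ := fun s => ∑ l, w l * ∫ u, G (x + s • u) l ∂(stdGaussian (Eu d))
  let P' : ℝ → ℝ := fun s => ∑ l, w l * ∫ u, ∑ i, A i l (x + s • u) * u i ∂(stdGaussian (Eu d))
  have hP : ∀ s, HasDerivAt P (P' s) s := by
    intro s
    refine HasDerivAt.fun_sum fun l _ => ?_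
    refine HasDerivAt.const_mul _ ?_
    exact hasDerivAt_integral_stdGaussian (g := fun z => G z l) (g' := fun i => A i l) hM
      (hf.hasLineDerivAt_grad l) (hf.continuous l) (hf.bound l) (hGB l)
      (c := fun s u => x + s • u) (c' := fun s u => u) (K := 1)
      (fun s u => by simpa using ((hasDerivAt_id s).smul_const u).const_add x)
      hline (fun _ => continuous_id) (fun s u => by simp) s
  -- rotation invariance in the `(l, r)` plane, followed by the symmetry `A l r = A r l`
  have hswap : ∀ s : ℝ, 0 < s → ∀ l r, ∫ u, A r l (x + s • u) * u r ∂(stdGaussian (Eu d))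
      = ∫ u, A r r (x + s • u) * u l ∂(stdGaussian (Eu d)) := by
    intro s hs l r
    have h := integral_partial_mul_comm (g := fun u => G (x + s • u) r)
      (g' := fun i u => s * A i r (x + s • u)) (M := s * M) (B := B) (by positivity)
      (fun i u => by
        have h1 := ((hf.hasFDerivAt_grad r (x + s • u)).comp u
          (((hasFDerivAt_id u).const_smul s).const_add x)).hasLineDerivAt (basisVec i)
        refine HasDerivAt.congr_deriv h1 ?_
        simp [basisVec])
      (fun i => ((hf.continuous r i).comp (hline s)).const_mul s)
      (fun i u => by
        rw [abs_mul, abs_of_pos hs]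
        exact mul_le_mul_of_nonneg_left (hf.bound r i _) hs.le)
      (fun u => hGB r _) l r
    simp only [mul_assoc, integral_const_mul] at h
    have h2 := mul_left_cancel₀ hs.ne' h
    simpa only [hf.symm l r] using h2
  -- `P' s` is the mean of `tr A * ⟪w, u⟫`
  have hP'le : ∀ s, 0 < s → P' s ≤ d * M * ‖w‖ := by
    intro s hs
    have e : P' s = ∫ u, (∑ r, A r r (x + s • u)) * inner ℝ w u ∂(stdGaussian (Eu d)) := by
      have e1 : ∀ u : Eu d, (∑ r, A r r (x + s • u)) * inner ℝ w u
          = ∑ l, w l * ∑ r, A r r (x + s • u) * u l := by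
        intro u
        simp only [PiLp.inner_apply, RCLike.inner_apply, conj_trivial]
        rw [Finset.mul_sum]
        refine Finset.sum_congr rfl fun l _ => ?_
        rw [← Finset.sum_mul]
        ring
      simp only [e1]
      rw [integral_finsetSum _ fun l _ =>
        (integrable_finsetSum _ fun r _ => hint r r l s).const_mul _]
      refine Finset.sum_congr rfl fun l _ => ?_
      rw [integral_const_mul, integral_finsetSum _ fun r _ => hint r l r s,
        integral_finsetSum _ fun r _ => hint r r l s]
      congr 1
      exact Finset.sum_congr rfl fun r _ => hswap s hs l r
    have habs : Integrable (fun u : Eu d => |inner ℝ w u|) (stdGaussian (Eu d)) := by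
      refine (integrable_norm_stdGaussian.const_mul ‖w‖).mono' (by fun_prop)
        (ae_of_all _ fun u => ?_)
      rw [Real.norm_eq_abs, abs_abs]
      exact abs_real_inner_le_norm w u
    rw [e]
    calc ∫ u, (∑ r, A r r (x + s • u)) * inner ℝ w u ∂(stdGaussian (Eu d))
        ≤ ‖∫ u, (∑ r, A r r (x + s • u)) * inner ℝ w u ∂(stdGaussian (Eu d))‖ := Real.le_norm_self _
      _ ≤ ∫ u, d * M * |inner ℝ w u| ∂(stdGaussian (Eu d)) := by
          refine norm_integral_le_of_norm_le (habs.const_mul _) (ae_of_all _ fun u => ?_)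
          rw [norm_mul]
          refine mul_le_mul_of_nonneg_right ?_ (abs_nonneg _)
          calc ‖∑ r, A r r (x + s • u)‖ ≤ ∑ _r : Fin d, M :=
                norm_sum_le_of_le _ fun r _ => hf.bound r r _
            _ = d * M := by simp
      _ = d * M * ∫ u, |inner ℝ w u| ∂(stdGaussian (Eu d)) := integral_const_mul _ _
      _ ≤ d * M * ‖w‖ := by
          gcongr
          exact integral_abs_inner_stdGaussian_le w
  obtain ⟨s, hs, hse⟩ := exists_hasDerivAt_eq_slope P P' hb
    (fun t _ => (hP t).continuousAt.continuousWithinAt) (fun t _ => hP t)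
  have hdiff : P b - P 0 = ‖w‖ ^ 2 := by
    simp only [P]
    rw [← Finset.sum_sub_distrib, EuclideanSpace.real_norm_sq_eq]
    refine Finset.sum_congr rfl fun l _ => ?_
    rw [← mul_sub, sq]
    congr 1
    rw [hw l]
    simp
  have h1 := hP'le s hs.1
  rw [hse, hdiff, sub_zero, div_le_iff₀ hb] at h1
  rcases (norm_nonneg w).eq_or_lt with h0 | h0
  · rw [← h0]; positivity
  · nlinarith

/-- The mean square change of the gradient under Gaussian noise of level `b`. -/
theorem integral_norm_grad_sub_sq_le (hf : HasBoundedHessian f G A M) (hB : ∀ x, ‖G x‖ ≤ B)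
    (x : Eu d) {b : ℝ} (hb : 0 < b) :
    ∫ u, ‖G (x + b • u) - G x‖ ^ 2 ∂(stdGaussian (Eu d)) ≤ 2 * (b * (d * M)) ^ 2 := by
  have hM := hf.nonneg
  have hline : Continuous fun u : Eu d => x + b • u := by fun_prop
  have hGc : ∀ l, Continuous fun u : Eu d => G (x + b • u) l := fun l =>
    (EuclideanSpace.proj l : Eu d →L[ℝ] ℝ).continuous.comp (hf.continuous_grad.comp hline)
  have hGB : ∀ l z, |G z l| ≤ B := fun l z => (abs_apply_le_norm _ l).trans (hB z)
  have hi1 : ∀ l, Integrable (fun u => G (x + b • u) l) (stdGaussian (Eu d)) := fun l =>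
    Integrable.of_bound (hGc l).aestronglyMeasurable B (ae_of_all _ fun u => hGB l _)
  have hi2 : ∀ l, Integrable (fun u => G (x + b • u) l ^ 2) (stdGaussian (Eu d)) := fun l =>
    Integrable.of_bound ((hGc l).pow 2).aestronglyMeasurable (B ^ 2) (ae_of_all _ fun u => by
      rw [norm_pow]; exact pow_le_pow_left₀ (norm_nonneg _) (hGB l _) 2)
  have hi3 : ∀ l, Integrable (fun u => (G (x + b • u) l - G x l) ^ 2) (stdGaussian (Eu d)) := by
    intro l
    have h : Integrable (fun u => G (x + b • u) l ^ 2 - 2 * G x l * G (x + b • u) l + G x l ^ 2)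
      (stdGaussian (Eu d)) := ((hi2 l).sub ((hi1 l).const_mul _)).add (integrable_const _)
    refine h.congr (ae_of_all _ fun u => ?_)
    simp only
    ring
  have hvar : ∀ l, ∫ u, G (x + b • u) l ^ 2 ∂(stdGaussian (Eu d))
      - (∫ u, G (x + b • u) l ∂(stdGaussian (Eu d))) ^ 2 ≤ d * (b * M) ^ 2 := by
    intro l
    have hmap := map_pi_eq_stdGaussian (ι := Fin d)
    have hcont : Continuous (WithLp.toLp 2 : (Fin d → ℝ) → Eu d) := PiLp.continuous_toLp 2 _
    have key := variance_pi_le_of_lipschitz (ν := gaussianReal 0 1) (M := b * M) (B := B)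
      (by simpa using (IsGaussian.memLp_two_id (μ := gaussianReal 0 1)).integrable_sq)
      (by
        have h := variance_id_gaussianReal (μ := 0) (v := 1)
        rw [variance_of_integral_eq_zero (by fun_prop) (by simp)] at h
        simpa using h.le)
      (F := fun y => G (x + b • WithLp.toLp 2 y) l) ((hGc l).comp hcont) (fun y => hGB l _)
      (fun y z => by
        have := hf.abs_grad_sub_le l (x + b • WithLp.toLp 2 z) (x + b • WithLp.toLp 2 y)
        refine this.trans (le_of_eq ?_)
        rw [mul_comm b M, mul_assoc, Finset.mul_sum _ _ b]
        congr 1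
        refine Finset.sum_congr rfl fun i _ => ?_
        simp [← mul_sub, abs_mul, abs_of_pos hb])
    rw [← hmap,
      integral_map (f := fun u => G (x + b • u) l ^ 2) hcont.aemeasurable
        ((hGc l).pow 2).aestronglyMeasurable,
      integral_map hcont.aemeasurable (hGc l).aestronglyMeasurable]
    exact key
  let w : Eu d := WithLp.toLp 2 fun l => ∫ u, G (x + b • u) l ∂(stdGaussian (Eu d)) - G x l
  have hw := hf.norm_integral_grad_sub_le hB x hb (w := w) fun l => rfl
  have hw2 : ∑ l, (∫ u, G (x + b • u) l ∂(stdGaussian (Eu d)) - G x l) ^ 2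
      ≤ (b * (d * M)) ^ 2 := by
    have := pow_le_pow_left₀ (norm_nonneg _) hw 2
    rw [EuclideanSpace.real_norm_sq_eq] at this
    exact this
  have hl : ∀ l, ∫ u, (G (x + b • u) l - G x l) ^ 2 ∂(stdGaussian (Eu d))
      ≤ d * (b * M) ^ 2 + (∫ u, G (x + b • u) l ∂(stdGaussian (Eu d)) - G x l) ^ 2 := by
    intro l
    have e : ∫ u, (G (x + b • u) l - G x l) ^ 2 ∂(stdGaussian (Eu d))
        = ∫ u, G (x + b • u) l ^ 2 ∂(stdGaussian (Eu d))
          - 2 * G x l * ∫ u, G (x + b • u) l ∂(stdGaussian (Eu d)) + G x l ^ 2 := by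
      have h3 : Integrable (fun u => G (x + b • u) l ^ 2 - 2 * G x l * G (x + b • u) l)
        (stdGaussian (Eu d)) := (hi2 l).sub ((hi1 l).const_mul _)
      have h4 : (fun u => (G (x + b • u) l - G x l) ^ 2)
          = fun u => G (x + b • u) l ^ 2 - 2 * G x l * G (x + b • u) l + G x l ^ 2 := by
        ext u; ring
      rw [h4, integral_add h3 (integrable_const _), integral_sub (hi2 l) ((hi1 l).const_mul _),
        integral_const_mul]
      simp
    rw [e]
    linarith [hvar l]
  simp only [EuclideanSpace.real_norm_sq_eq, PiLp.sub_apply]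
  rw [integral_finsetSum _ fun l _ => hi3 l]
  calc ∑ l, ∫ u, (G (x + b • u) l - G x l) ^ 2 ∂(stdGaussian (Eu d))
      ≤ ∑ l : Fin d, (d * (b * M) ^ 2
        + (∫ u, G (x + b • u) l ∂(stdGaussian (Eu d)) - G x l) ^ 2) :=
        Finset.sum_le_sum fun l _ => hl l
    _ = d * (d * (b * M) ^ 2)
        + ∑ l, (∫ u, G (x + b • u) l ∂(stdGaussian (Eu d)) - G x l) ^ 2 := by
        rw [Finset.sum_add_distrib]; simp
    _ ≤ 2 * (b * (d * M)) ^ 2 := by nlinarith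

end HasBoundedHessian

end

/-! ### Concentration -/

section

variable {d : ℕ}

theorem exp_le_one_add_add_sq_mul_exp (y : ℝ) :
    Real.exp y ≤ 1 + y + y ^ 2 * Real.exp |y| := by
  have h := Complex.norm_exp_sub_sum_le_norm_mul_exp (y : ℂ) 2
  simp only [Finset.sum_range_succ, Finset.sum_range_zero] at h
  have e : (Complex.exp y - (0 + (y : ℂ) ^ 0 / (Nat.factorial 0) + (y : ℂ) ^ 1 / (Nat.factorial 1)))
      = ((Real.exp y - (1 + y) : ℝ) : ℂ) := by
    push_cast
    simp
  rw [e, Complex.norm_real, Complex.norm_real, Real.norm_eq_abs, Real.norm_eq_abs, sq_abs] at h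
  linarith [le_abs_self (Real.exp y - (1 + y))]

theorem integrable_exp_mul_norm_stdGaussian (a : ℝ) :
    Integrable (fun u : Eu d => Real.exp (a * ‖u‖)) (stdGaussian (Eu d)) := by
  obtain ⟨C, hC, h⟩ := IsGaussian.exists_integrable_exp_sq (stdGaussian (Eu d))
  refine (h.const_mul (Real.exp (a ^ 2 / (4 * C)))).mono' (by fun_prop) (ae_of_all _ fun u => ?_)
  rw [Real.norm_eq_abs, Real.abs_exp, ← Real.exp_add, Real.exp_le_exp]
  have h1 : 0 ≤ (a - 2 * C * ‖u‖) ^ 2 / (4 * C) := by positivity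
  have h2 : (a - 2 * C * ‖u‖) ^ 2 / (4 * C) = a ^ 2 / (4 * C) + C * ‖u‖ ^ 2 - a * ‖u‖ := by
    field_simp; ring
  linarith

/-- Subexponential concentration for sums of independent functions of standard Gaussian vectors,
each of linear growth around the origin with constant `A`. The exponential moment is taken at the
fixed argument `1 / √n`, so the deviation is linear in `s`. -/
theorem exists_concentration (d : ℕ) : ∃ K : ℝ, 0 < K ∧ ∀ (n : ℕ), 1 ≤ n →
    ∀ (W : Fin n → Eu d → ℝ) (A : ℝ), 0 ≤ A → (∀ i, Continuous (W i)) →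
      (∀ i v, |W i v - W i 0| ≤ A * ‖v‖) → ∀ s : ℝ,
      (gaussianNoise d n).real {v | √n * (A * (K + s)) <
        ∑ i, W i (v i) - ∑ i, ∫ u, W i u ∂(stdGaussian (Eu d))} ≤ Real.exp (-s) := by
  set m : ℝ := ∫ u : Eu d, ‖u‖ ∂(stdGaussian (Eu d)) with hm
  have hm0 : 0 ≤ m := integral_nonneg fun u => norm_nonneg _
  have hintE : ∀ a : ℝ, Integrable (fun u : Eu d => Real.exp (a * (‖u‖ + m)))
      (stdGaussian (Eu d)) := by
    intro a
    refine ((integrable_exp_mul_norm_stdGaussian a).mul_const (Real.exp (a * m))).congr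
      (ae_of_all _ fun u => ?_)
    simp only
    rw [← Real.exp_add]; ring_nf
  set K : ℝ := ∫ u : Eu d, 2 * Real.exp (2 * (‖u‖ + m)) ∂(stdGaussian (Eu d)) with hK
  have hKpos : 0 < K := by
    refine lt_of_lt_of_le zero_lt_two ?_
    have : ∫ _u : Eu d, (2 : ℝ) ∂(stdGaussian (Eu d)) ≤ K := by
      refine integral_mono (integrable_const _) ((hintE 2).const_mul 2) fun u => ?_
      have : 1 ≤ Real.exp (2 * (‖u‖ + m)) := Real.one_le_exp (by positivity)
      simp only
      linarith
    simpa using this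
  refine ⟨K, hKpos, fun n hn W A hA hWc hW s => ?_⟩
  have hn0 : (0 : ℝ) < n := by exact_mod_cast hn
  have hsn : 0 < √(n : ℝ) := Real.sqrt_pos.2 hn0
  have hsn1 : 1 ≤ √(n : ℝ) := Real.one_le_sqrt.2 (by exact_mod_cast hn)
  have hprob : IsProbabilityMeasure (gaussianNoise d n) := by
    unfold gaussianNoise; infer_instance
  have hWi : ∀ i, Integrable (W i) (stdGaussian (Eu d)) := by
    intro i
    refine ((integrable_norm_stdGaussian.const_mul A).add (integrable_const |W i 0|)).mono'
      (hWc i).aestronglyMeasurable (ae_of_all _ fun u => ?_)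
    have h1 := hW i u
    have h2 := abs_sub_abs_le_abs_sub (W i u) (W i 0)
    simp only [Pi.add_apply, Real.norm_eq_abs]
    linarith
  have hcen : ∀ i, |W i 0 - ∫ u, W i u ∂(stdGaussian (Eu d))| ≤ A * m := by
    intro i
    have e : W i 0 - ∫ u, W i u ∂(stdGaussian (Eu d))
        = ∫ u, (W i 0 - W i u) ∂(stdGaussian (Eu d)) := by
      rw [integral_sub (integrable_const _) (hWi i)]; simp
    rw [e, hm, ← integral_const_mul, ← Real.norm_eq_abs]
    refine norm_integral_le_of_norm_le (integrable_norm_stdGaussian.const_mul A)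
      (ae_of_all _ fun u => ?_)
    rw [norm_sub_rev]
    exact hW i u
  rcases hA.eq_or_lt with rfl | hApos
  · have hconst : ∀ i v, W i v = ∫ u, W i u ∂(stdGaussian (Eu d)) := by
      intro i v
      have h1 := hW i v
      have h2 := hcen i
      rw [zero_mul] at h1 h2
      have h1' := abs_nonpos_iff.1 h1
      have h2' := abs_nonpos_iff.1 h2
      linarith
    have hempty : {v : Fin n → Eu d | √n * (0 * (K + s)) <
        ∑ i, W i (v i) - ∑ i, ∫ u, W i u ∂(stdGaussian (Eu d))} = ∅ := by
      ext v
      have : ∑ i, W i (v i) = ∑ i, ∫ u, W i u ∂(stdGaussian (Eu d)) :=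
        Finset.sum_congr rfl fun i _ => hconst i (v i)
      simp [this]
    rw [hempty]
    simpa using (Real.exp_pos _).le
  -- centred and scaled so that the exponential moment is needed at the argument `1` only
  let Y : Fin n → Eu d → ℝ := fun i v =>
    (W i v - ∫ u, W i u ∂(stdGaussian (Eu d))) / (A * √n)
  have hYc : ∀ i, Continuous (Y i) := fun i => ((hWc i).sub continuous_const).div_const _
  have hYabs : ∀ i v, |Y i v| ≤ (‖v‖ + m) / √n := by
    intro i v
    simp only [Y]
    rw [abs_div, abs_of_pos (by positivity : 0 < A * √(n : ℝ)), div_le_div_iff₀ (by positivity) hsn]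
    have h1 : |W i v - ∫ u, W i u ∂(stdGaussian (Eu d))| ≤ A * (‖v‖ + m) := by
      have := abs_add_le (W i v - W i 0) (W i 0 - ∫ u, W i u ∂(stdGaussian (Eu d)))
      rw [sub_add_sub_cancel] at this
      linarith [hW i v, hcen i]
    calc _ ≤ A * (‖v‖ + m) * √n := by gcongr
      _ = _ := by ring
  have hYle : ∀ i v, |Y i v| ≤ ‖v‖ + m := fun i v =>
    (hYabs i v).trans (div_le_self (by positivity) hsn1)
  have hYint : ∀ i, Integrable (Y i) (stdGaussian (Eu d)) := fun i =>
    ((hWi i).sub (integrable_const _)).div_const _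
  have hY0 : ∀ i, ∫ v, Y i v ∂(stdGaussian (Eu d)) = 0 := by
    intro i
    simp only [Y]
    rw [integral_div, integral_sub (hWi i) (integrable_const _)]
    simp
  have hexpint : ∀ i, Integrable (fun v => Real.exp (Y i v)) (stdGaussian (Eu d)) := by
    intro i
    refine (hintE 1).mono' (Real.continuous_exp.comp (hYc i)).aestronglyMeasurable
      (ae_of_all _ fun v => ?_)
    rw [Real.norm_eq_abs, Real.abs_exp, one_mul, Real.exp_le_exp]
    exact (le_abs_self _).trans (hYle i v)
  have hmgf : ∀ i, ∫ v, Real.exp (Y i v) ∂(stdGaussian (Eu d)) ≤ Real.exp (K / n) := by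
    intro i
    have hpt : ∀ v, Real.exp (Y i v) ≤ 1 + Y i v + (2 * Real.exp (2 * (‖v‖ + m))) / n := by
      intro v
      refine (exp_le_one_add_add_sq_mul_exp _).trans ?_
      have hz : 0 ≤ ‖v‖ + m := by positivity
      have h1 : Y i v ^ 2 ≤ (‖v‖ + m) ^ 2 / n := by
        have := pow_le_pow_left₀ (abs_nonneg _) (hYabs i v) 2
        rwa [sq_abs, div_pow _ (√(n : ℝ)), Real.sq_sqrt hn0.le] at this
      have h2 : Real.exp |Y i v| ≤ Real.exp (‖v‖ + m) := Real.exp_le_exp.2 (hYle i v)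
      have h3 : (‖v‖ + m) ^ 2 ≤ 2 * Real.exp (‖v‖ + m) := by
        have := Real.quadratic_le_exp_of_nonneg hz
        nlinarith
      have h4 : Y i v ^ 2 * Real.exp |Y i v| ≤ 2 * Real.exp (‖v‖ + m) / n * Real.exp (‖v‖ + m) := by
        refine mul_le_mul (h1.trans ?_) h2 (Real.exp_pos _).le (by positivity)
        gcongr
      have h5 : 2 * Real.exp (‖v‖ + m) / n * Real.exp (‖v‖ + m)
          = 2 * Real.exp (2 * (‖v‖ + m)) / n := by
        rw [two_mul (‖v‖ + m), Real.exp_add (‖v‖ + m) (‖v‖ + m)]; ring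
      linarith
    have hb1 : Integrable (fun v => 1 + Y i v) (stdGaussian (Eu d)) :=
      (integrable_const _).add (hYint i)
    have hb2 : Integrable (fun v : Eu d => (2 * Real.exp (2 * (‖v‖ + m))) / n)
      (stdGaussian (Eu d)) := ((hintE 2).const_mul 2).div_const _
    calc ∫ v, Real.exp (Y i v) ∂(stdGaussian (Eu d))
        ≤ ∫ v, (1 + Y i v + (2 * Real.exp (2 * (‖v‖ + m))) / n) ∂(stdGaussian (Eu d)) :=
          integral_mono (hexpint i) (hb1.add hb2) hpt
      _ = 1 + K / n := by
          rw [integral_add hb1 hb2, integral_add (integrable_const _) (hYint i), hY0, integral_div]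
          simp [hK]
      _ ≤ Real.exp (K / n) := by linarith [Real.add_one_le_exp (K / n)]
  have hprod : ∫ v, ∏ i, Real.exp (Y i (v i)) ∂(gaussianNoise d n) ≤ Real.exp K := by
    unfold gaussianNoise
    rw [integral_fintype_prod_eq_prod (fun i v => Real.exp (Y i v))]
    calc ∏ i, ∫ v, Real.exp (Y i v) ∂(stdGaussian (Eu d)) ≤ ∏ _i : Fin n, Real.exp (K / n) :=
          Finset.prod_le_prod (fun i _ => integral_nonneg fun v => (Real.exp_pos _).le)
            fun i _ => hmgf i
      _ = Real.exp K := by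
          rw [Finset.prod_const, Finset.card_univ, Fintype.card_fin, ← Real.exp_nat_mul]
          congr 1
          field_simp
  have hpint : Integrable (fun v : Fin n → Eu d => ∏ i, Real.exp (Y i (v i)))
      (gaussianNoise d n) := by
    unfold gaussianNoise
    exact Integrable.fintype_prod (f := fun i v => Real.exp (Y i v)) hexpint
  have hmarkov := mul_meas_ge_le_integral_of_nonneg (μ := gaussianNoise d n)
    (f := fun v => ∏ i, Real.exp (Y i (v i)))
    (ae_of_all _ fun v => Finset.prod_nonneg fun i _ => (Real.exp_pos _).le) hpint
    (Real.exp (K + s))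
  have hsub : {v : Fin n → Eu d | √n * (A * (K + s)) <
      ∑ i, W i (v i) - ∑ i, ∫ u, W i u ∂(stdGaussian (Eu d))}
      ⊆ {v | Real.exp (K + s) ≤ ∏ i, Real.exp (Y i (v i))} := by
    intro v hv
    simp only [Set.mem_ofPred_eq] at hv ⊢
    rw [← Real.exp_sum, Real.exp_le_exp]
    simp only [Y]
    rw [← Finset.sum_div, Finset.sum_sub_distrib, le_div_iff₀ (by positivity)]
    linarith
  have h1 := (mul_le_mul_of_nonneg_left (measureReal_mono (μ := gaussianNoise d n) hsub)
    (Real.exp_pos (K + s)).le).trans (hmarkov.trans hprod)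
  rw [Real.exp_add, mul_assoc] at h1
  have h2 := le_of_mul_le_mul_left (h1.trans_eq (mul_one _).symm) (Real.exp_pos K)
  rw [Real.exp_neg, ← one_div, le_div_iff₀ (Real.exp_pos s)]
  linarith

end

/-! ### Smooth feature maps and the discrepancy -/

section

variable {d : ℕ}

/-- `φ` is a feature map of the kernel `k` with values in a Hilbert space, with strong partial
derivatives `ψ l` of first and `χ r l` of second order (`l` taken first), all of square norm at
most `κ`. -/
structure IsSmoothFeature {H : Type*} [NormedAddCommGroup H] [InnerProductSpace ℝ H]
    (k : Eu d → Eu d → ℝ) (κ : ℝ) (φ : Eu d → H) (ψ : Fin d → Eu d → H)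
    (χ : Fin d → Fin d → Eu d → H) : Prop where
  inner_eq : ∀ x y, inner ℝ (φ x) (φ y) = k x y
  hasLineDerivAt : ∀ l x, HasLineDerivAt ℝ φ (ψ l x) x (basisVec l)
  hasLineDerivAt₂ : ∀ l r x, HasLineDerivAt ℝ (ψ l) (χ r l x) x (basisVec r)
  symm : ∀ l r x, χ r l x = χ l r x
  continuous₂ : ∀ l r, Continuous (χ r l)
  norm_sq_le : ∀ x, ‖φ x‖ ^ 2 ≤ κ
  norm_sq_le₁ : ∀ l x, ‖ψ l x‖ ^ 2 ≤ κ
  norm_sq_le₂ : ∀ l r x, ‖χ r l x‖ ^ 2 ≤ κ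

theorem exists_isSmoothFeature {k : Eu d → Eu d → ℝ} {μ : Measure (Eu d)} {κ : ℝ}
    (hk : IsPSDKernel k) (hd : IntegrableDifferentiable k μ) (hr : KernelRegularity k κ) :
    ∃ (H : Type) (_ : NormedAddCommGroup H) (_ : InnerProductSpace ℝ H) (_ : CompleteSpace H)
      (φ : Eu d → H) (ψ : Fin d → Eu d → H) (χ : Fin d → Fin d → Eu d → H),
      IsSmoothFeature k κ φ ψ χ := by
  obtain ⟨H, _, _, _, φ, hφ⟩ := hk.exists_featureMap
  choose ψ hψ hψi using fun l => exists_feature_deriv hφ (hd.hasPd2 l) (hd.hasPd12 l)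
    (hd.continuous_pd12 l)
  choose χ hχl hχr hχc hχi using fun r l => exists_feature_deriv₂ hφ (hd.hasPd2 l)
    (hr.hasPd22 l r) (hr.hasPd122 l r) (hr.hasPd1122 l r) (hr.continuous_pd1122 l r) (hψ l) (hψ r)
  refine ⟨H, _, _, inferInstance, φ, ψ, χ, hφ, hψ, fun l r x => hχl r l x, fun l r x => ?_,
    fun l r => hχc r l, fun x => ?_, fun l x => ?_, fun l r x => ?_⟩
  · exact (hχr r l x).unique (hχl l r x)
  · rw [← real_inner_self_eq_norm_sq, hφ]
    exact (le_abs_self _).trans (hr.bound x)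
  · rw [← real_inner_self_eq_norm_sq, hψi]
    exact (le_abs_self _).trans (hr.bound_pd12 l x)
  · rw [← real_inner_self_eq_norm_sq, hχi]
    exact (le_abs_self _).trans (hr.bound_pd1122 l r x)

theorem integral_empirical {n : ℕ} {E : Type*} [NormedAddCommGroup E] [NormedSpace ℝ E]
    [CompleteSpace E] (x : Fin n → Eu d) (g : Eu d → E) :
    ∫ z, g z ∂(empirical x) = (n : ℝ)⁻¹ • ∑ i, g (x i) := by
  unfold empirical
  rw [integral_smul_measure, integral_finsetSum_measure]
  · simp
  · intro i _
    exact integrable_dirac (by simp [enorm_lt_top])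

theorem isProbabilityMeasure_empirical {n : ℕ} (hn : 1 ≤ n) (x : Fin n → Eu d) :
    IsProbabilityMeasure (empirical x) := by
  constructor
  have hn0 : (n : ℝ≥0∞) ≠ 0 := by
    simp only [ne_eq, Nat.cast_eq_zero]
    omega
  simp only [empirical, Measure.smul_apply, Measure.coe_finsetSum, Finset.sum_apply, measure_univ,
    Finset.sum_const, Finset.card_univ, Fintype.card_fin, smul_eq_mul, nsmul_eq_mul, mul_one]
  exact ENNReal.inv_mul_cancel hn0 (ENNReal.natCast_ne_top n)

namespace IsSmoothFeature

variable {k : Eu d → Eu d → ℝ} {κ : ℝ} {H : Type*} [NormedAddCommGroup H] [InnerProductSpace ℝ H]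
  {φ : Eu d → H} {ψ : Fin d → Eu d → H} {χ : Fin d → Fin d → Eu d → H}

theorem nonneg (h : IsSmoothFeature k κ φ ψ χ) : 0 ≤ κ := (sq_nonneg _).trans (h.norm_sq_le 0)

theorem norm_sub_sq_le (h : IsSmoothFeature k κ φ ψ χ) (x v : Eu d) :
    ‖φ (x + v) - φ x‖ ^ 2 ≤ d * κ * ‖v‖ ^ 2 := by
  have h1 := norm_add_sub_le_of_partial h.hasLineDerivAt (C := √κ) x v
    (fun z _ r => Real.le_sqrt_of_sq_le (h.norm_sq_le₁ r z))
  calc ‖φ (x + v) - φ x‖ ^ 2 ≤ (√κ * ∑ i, |v i|) ^ 2 := by gcongr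
    _ = κ * (∑ i, |v i|) ^ 2 := by rw [mul_pow, Real.sq_sqrt h.nonneg]
    _ ≤ κ * (d * ‖v‖ ^ 2) := mul_le_mul_of_nonneg_left (sum_abs_sq_le v) h.nonneg
    _ = _ := by ring

theorem continuous (h : IsSmoothFeature k κ φ ψ χ) : Continuous φ := by
  have : LipschitzWith (Real.toNNReal √(d * κ)) φ := by
    refine LipschitzWith.of_dist_le' fun x y => ?_
    rw [dist_eq_norm, dist_eq_norm]
    have h1 := Real.sqrt_le_sqrt (h.norm_sub_sq_le y (x - y))
    rw [Real.sqrt_sq (norm_nonneg _), Real.sqrt_mul (mul_nonneg (Nat.cast_nonneg d) h.nonneg),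
      Real.sqrt_sq (norm_nonneg _), add_sub_cancel] at h1
    exact h1
  exact this.continuous

theorem pd1_eq (h : IsSmoothFeature k κ φ ψ χ) (l : Fin d) (x y : Eu d) :
    pd1 l k x y = inner ℝ (ψ l x) (φ y) := by
  have h1 : HasLineDerivAt ℝ (fun z => k z y) (inner ℝ (ψ l x) (φ y)) x (basisVec l) := by
    simp only [← h.inner_eq]
    have h2 : HasDerivAt (fun t : ℝ => inner ℝ (φ (x + t • basisVec l)) (φ y))
      (inner ℝ (φ (x + (0 : ℝ) • basisVec l)) 0 + inner ℝ (ψ l x) (φ y)) 0 :=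
      HasDerivAt.inner ℝ (h.hasLineDerivAt l x) (hasDerivAt_const _ _)
    exact h2.congr_deriv (by simp)
  exact h1.lineDeriv

theorem integrable (h : IsSmoothFeature k κ φ ψ χ) (P : Measure (Eu d)) [IsProbabilityMeasure P] :
    Integrable φ P :=
  Integrable.of_bound h.continuous.aestronglyMeasurable √κ
    (ae_of_all _ fun x => Real.le_sqrt_of_sq_le (h.norm_sq_le x))

theorem norm_integral_le (h : IsSmoothFeature k κ φ ψ χ) (P : Measure (Eu d))
    [IsProbabilityMeasure P] : ‖∫ x, φ x ∂P‖ ≤ √κ := by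
  have := norm_integral_le_of_norm_le_const (μ := P) (f := φ)
    (ae_of_all _ fun x => Real.le_sqrt_of_sq_le (h.norm_sq_le x))
  simpa using this

/-- The witness function `⟪φ ·, m⟫` of an element `m` of the Hilbert space is twice continuously
differentiable with derivatives controlled by `‖m‖`. -/
theorem hasBoundedHessian (h : IsSmoothFeature k κ φ ψ χ) (m : H) :
    HasBoundedHessian (fun z => inner ℝ (φ z) m)
      (fun z => WithLp.toLp 2 fun l => inner ℝ (ψ l z) m)
      (fun r l z => inner ℝ (χ r l z) m) (√κ * ‖m‖) where
  nonneg := by positivity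
  hasLineDerivAt l x := by
    have h2 : HasDerivAt (fun t : ℝ => inner ℝ (φ (x + t • basisVec l)) m)
      (inner ℝ (φ (x + (0 : ℝ) • basisVec l)) 0 + inner ℝ (ψ l x) m) 0 :=
      HasDerivAt.inner ℝ (h.hasLineDerivAt l x) (hasDerivAt_const _ _)
    exact h2.congr_deriv (by simp)
  hasLineDerivAt_grad l r x := by
    have h2 : HasDerivAt (fun t : ℝ => inner ℝ (ψ l (x + t • basisVec r)) m)
      (inner ℝ (ψ l (x + (0 : ℝ) • basisVec r)) 0 + inner ℝ (χ r l x) m) 0 :=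
      HasDerivAt.inner ℝ (h.hasLineDerivAt₂ l r x) (hasDerivAt_const _ _)
    exact h2.congr_deriv (by simp)
  symm l r x := by rw [h.symm]
  continuous l r := (h.continuous₂ l r).inner continuous_const
  bound l r x := (abs_real_inner_le_norm _ _).trans
    (mul_le_mul_of_nonneg_right (Real.le_sqrt_of_sq_le (h.norm_sq_le₂ l r x)) (norm_nonneg _))

theorem norm_grad_sq_le (h : IsSmoothFeature k κ φ ψ χ) (m : H) (z : Eu d) :
    ‖(WithLp.toLp 2 fun l => inner ℝ (ψ l z) m : Eu d)‖ ^ 2 ≤ d * κ * ‖m‖ ^ 2 := by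
  rw [EuclideanSpace.real_norm_sq_eq]
  calc ∑ l, (inner ℝ (ψ l z) m) ^ 2 ≤ ∑ _l : Fin d, κ * ‖m‖ ^ 2 := by
        refine Finset.sum_le_sum fun l _ => ?_
        rw [← sq_abs]
        calc |inner ℝ (ψ l z) m| ^ 2 ≤ (‖ψ l z‖ * ‖m‖) ^ 2 :=
              pow_le_pow_left₀ (abs_nonneg _) (abs_real_inner_le_norm _ _) 2
          _ = ‖ψ l z‖ ^ 2 * ‖m‖ ^ 2 := by ring
          _ ≤ _ := mul_le_mul_of_nonneg_right (h.norm_sq_le₁ l z) (sq_nonneg _)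
    _ = _ := by simp; ring

variable [CompleteSpace H]

theorem integral_integral_kernel (h : IsSmoothFeature k κ φ ψ χ) (P Q : Measure (Eu d))
    [IsProbabilityMeasure P] [IsProbabilityMeasure Q] :
    ∫ x, ∫ y, k x y ∂Q ∂P = inner ℝ (∫ x, φ x ∂P) (∫ y, φ y ∂Q) := by
  simp only [← h.inner_eq]
  simp_rw [integral_inner (h.integrable Q), real_inner_comm (∫ y, φ y ∂Q)]
  rw [integral_inner (h.integrable P)]

/-- The maximum mean discrepancy is the distance of the mean embeddings. -/
theorem mmd_eq (h : IsSmoothFeature k κ φ ψ χ) (P Q : Measure (Eu d))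
    [IsProbabilityMeasure P] [IsProbabilityMeasure Q] :
    mmd k P Q = ‖∫ x, φ x ∂P - ∫ x, φ x ∂Q‖ := by
  unfold mmd mmdSq
  rw [h.integral_integral_kernel, h.integral_integral_kernel, h.integral_integral_kernel,
    real_inner_self_eq_norm_sq, real_inner_self_eq_norm_sq, ← norm_sub_sq_real,
    Real.sqrt_sq (norm_nonneg _)]

/-- The drift of the particle system is the gradient of the witness function of the difference of
the mean embeddings. -/
theorem drift_eq (h : IsSmoothFeature k κ φ ψ χ) {n : ℕ} (x : Fin n → Eu d) (μ : Measure (Eu d))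
    [IsProbabilityMeasure μ] (z : Eu d) :
    (n : ℝ)⁻¹ • (∑ j, grad1 k z (x j)) - ∫ y, grad1 k z y ∂μ
      = WithLp.toLp 2 fun l =>
        inner ℝ (ψ l z) (∫ y, φ y ∂(empirical x) - ∫ y, φ y ∂μ) := by
  have hint : Integrable (fun y => grad1 k z y) μ := by
    have hc : Continuous fun y => grad1 k z y := by
      unfold grad1
      refine (PiLp.continuous_toLp 2 _).comp (continuous_pi fun l => ?_)
      simp only [h.pd1_eq]
      exact continuous_const.inner h.continuous
    refine Integrable.of_bound hc.aestronglyMeasurable √(d * κ * κ) (ae_of_all _ fun y => ?_)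
    refine Real.le_sqrt_of_sq_le ?_
    simp only [grad1, h.pd1_eq]
    refine (h.norm_grad_sq_le (φ y) z).trans ?_
    exact mul_le_mul_of_nonneg_left (h.norm_sq_le y) (mul_nonneg (Nat.cast_nonneg d) h.nonneg)
  ext l
  have h1 : (∫ y, grad1 k z y ∂μ) l = inner ℝ (ψ l z) (∫ y, φ y ∂μ) := by
    have := (EuclideanSpace.proj l : Eu d →L[ℝ] ℝ).integral_comp_comm hint
    rw [← integral_inner (h.integrable μ)]
    simp only [← h.pd1_eq]
    exact this.symm
  rw [PiLp.sub_apply, h1, PiLp.smul_apply, WithLp.ofLp_sum, Finset.sum_apply, integral_empirical]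
  simp only [grad1, h.pd1_eq, inner_sub_right, real_inner_smul_right, inner_sum, smul_eq_mul]

theorem mean_Phi_eq (h : IsSmoothFeature k κ φ ψ χ) {n : ℕ} (hn : 1 ≤ n) (x : Fin n → Eu d)
    (μ : Measure (Eu d)) [IsProbabilityMeasure μ] (z : Eu d) :
    (n : ℝ)⁻¹ • ∑ j, Phi k μ z (x j)
      = -(WithLp.toLp 2 fun l =>
        inner ℝ (ψ l z) (∫ y, φ y ∂(empirical x) - ∫ y, φ y ∂μ) : Eu d) := by
  have hn0 : (n : ℝ) ≠ 0 := by
    simp only [ne_eq, Nat.cast_eq_zero]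
    omega
  rw [← h.drift_eq x μ z]
  simp only [Phi, Finset.sum_sub_distrib, Finset.sum_const, Finset.card_univ, Fintype.card_fin]
  rw [smul_sub, ← Nat.cast_smul_eq_nsmul ℝ, smul_smul, inv_mul_cancel₀ hn0, one_smul, neg_sub]

end IsSmoothFeature

end

/-! ### One step of the descent -/

section

variable {d : ℕ}

theorem abs_norm_sq_sub_le {E : Type*} [NormedAddCommGroup E] {a c : E} {R : ℝ} (ha : ‖a‖ ≤ R)
    (hc : ‖c‖ ≤ R) : |‖a‖ ^ 2 - ‖c‖ ^ 2| ≤ 2 * R * ‖a - c‖ := by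
  have h1 := abs_norm_sub_norm_le a c
  have h2 : |‖a‖ ^ 2 - ‖c‖ ^ 2| = (‖a‖ + ‖c‖) * |‖a‖ - ‖c‖| := by
    rw [sq_sub_sq, abs_mul, abs_of_nonneg (by positivity)]
  rw [h2]
  exact mul_le_mul (by linarith) h1 (abs_nonneg _) (by linarith [norm_nonneg a])

/-- The contribution of one particle at `x` to a bound for the increment of the squared
discrepancy, as a function of its noise `v`; here `G` is the gradient of the witness function.
The numerical coefficients come from Young's inequality with weight `3 / 4`, the second-order
terms taking up `3 / 16`. -/
noncomputable def stepEnergy (G : Eu d → Eu d) (γ b : ℝ) (x v : Eu d) : ℝ :=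
  γ * (-(17 / 16) * ‖G (x + b • v)‖ ^ 2 + 4 / 3 * ‖G (x + b • v) - G x‖ ^ 2)

theorem abs_stepEnergy_sub_le {G : Eu d → Eu d} {γ b R L : ℝ} (hγ : 0 ≤ γ) (hb : 0 ≤ b)
    (hR : ∀ z, ‖G z‖ ≤ R) (hL : ∀ x y, ‖G y - G x‖ ≤ L * ‖y - x‖) (x v : Eu d) :
    |stepEnergy G γ b x v - stepEnergy G γ b x 0| ≤ 5 * γ * R * L * b * ‖v‖ := by
  have hR0 : 0 ≤ R := (norm_nonneg _).trans (hR x)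
  have h1 := abs_norm_sq_sub_le (hR (x + b • v)) (hR x)
  have h2 : ‖G (x + b • v) - G x‖ ^ 2 ≤ 2 * R * ‖G (x + b • v) - G x‖ := by
    rw [sq]
    refine mul_le_mul_of_nonneg_right ?_ (norm_nonneg _)
    exact (norm_sub_le _ _).trans (by linarith [hR x, hR (x + b • v)])
  have h3 : ‖G (x + b • v) - G x‖ ≤ L * (b * ‖v‖) := by
    have := hL x (x + b • v)
    rwa [add_sub_cancel_left, norm_smul, Real.norm_eq_abs, abs_of_nonneg hb] at this
  have e : stepEnergy G γ b x v - stepEnergy G γ b x 0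
      = γ * (-(17 / 16) * (‖G (x + b • v)‖ ^ 2 - ‖G x‖ ^ 2)
        + 4 / 3 * ‖G (x + b • v) - G x‖ ^ 2) := by
    simp only [stepEnergy, smul_zero, add_zero, sub_self, norm_zero]
    ring
  rw [e, abs_mul, abs_of_nonneg hγ]
  have h4 : |-(17 / 16) * (‖G (x + b • v)‖ ^ 2 - ‖G x‖ ^ 2)
        + 4 / 3 * ‖G (x + b • v) - G x‖ ^ 2| ≤ 5 * R * ‖G (x + b • v) - G x‖ := by
    rw [abs_le] at h1 ⊢
    have h5 : 0 ≤ R * ‖G (x + b • v) - G x‖ := by positivity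
    have h6 := sq_nonneg ‖G (x + b • v) - G x‖
    constructor <;> nlinarith
  calc γ * _ ≤ γ * (5 * R * (L * (b * ‖v‖))) := by
        refine mul_le_mul_of_nonneg_left (h4.trans ?_) hγ
        exact mul_le_mul_of_nonneg_left h3 (by positivity)
    _ = _ := by ring

section Step

variable {k : Eu d → Eu d → ℝ} {κ : ℝ} {H : Type*} [NormedAddCommGroup H] [InnerProductSpace ℝ H]
  [CompleteSpace H] {φ : Eu d → H} {ψ : Fin d → Eu d → H} {χ : Fin d → Fin d → Eu d → H}

/-- The descent inequality for one step and a fixed value of the noise. -/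
theorem IsSmoothFeature.mmd_step_sq_le (h : IsSmoothFeature k κ φ ψ χ) {n : ℕ} (hn : 1 ≤ n)
    (μ : Measure (Eu d)) [IsProbabilityMeasure μ] {γ : ℝ} (hγ : 0 < γ)
    (hγκ : 16 * γ * (d * κ) ≤ 1) (b : ℝ) (v x : Fin n → Eu d) {G : Eu d → Eu d}
    (hG : G = fun z => WithLp.toLp 2 fun l =>
      inner ℝ (ψ l z) (∫ y, φ y ∂(empirical x) - ∫ y, φ y ∂μ)) :
    mmd k (empirical (step k μ γ b v x)) μ ^ 2 ≤ mmd k (empirical x) μ ^ 2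
      + (n : ℝ)⁻¹ * ∑ i, stepEnergy G γ b (x i) (v i) := by
  have hn0 : (0 : ℝ) < n := by exact_mod_cast hn
  have := isProbabilityMeasure_empirical hn x
  have := isProbabilityMeasure_empirical hn (step k μ γ b v x)
  set m := ∫ y, φ y ∂(empirical x) - ∫ y, φ y ∂μ with hm
  have hκ := h.nonneg
  have hm2 : ‖m‖ ≤ 2 * √κ := by
    have h1 := h.norm_integral_le (empirical x)
    have h2 := h.norm_integral_le μ
    exact (norm_sub_le _ _).trans (by linarith)
  have hf := h.hasBoundedHessian m
  let g : Fin n → Eu d := fun i => G (x i + b • v i)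
  have hstep : ∀ i, step k μ γ b v x i = x i + -(γ • g i) := by
    intro i
    simp only [step, g, hG]
    rw [h.drift_eq x μ, sub_eq_add_neg]
  let D : Fin n → H := fun i => φ (x i + -(γ • g i)) - φ (x i)
  have hm' : ∫ y, φ y ∂(empirical (step k μ γ b v x)) - ∫ y, φ y ∂μ
      = m + (n : ℝ)⁻¹ • ∑ i, D i := by
    rw [hm, integral_empirical, integral_empirical]
    simp only [hstep, D, Finset.sum_sub_distrib, smul_sub]
    abel
  rw [h.mmd_eq, h.mmd_eq, ← hm, hm', norm_add_sq_real]
  have hsq : ‖(n : ℝ)⁻¹ • ∑ i, D i‖ ^ 2 ≤ (n : ℝ)⁻¹ * ∑ i, ‖D i‖ ^ 2 := by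
    have h1 : ‖∑ i, D i‖ ^ 2 ≤ n * ∑ i, ‖D i‖ ^ 2 := by
      have h2 := sq_sum_le_card_mul_sum_sq (s := Finset.univ) (f := fun i => ‖D i‖)
      rw [Finset.card_univ, Fintype.card_fin] at h2
      exact (pow_le_pow_left₀ (norm_nonneg _) (norm_sum_le _ _) 2).trans h2
    rw [norm_smul, mul_pow, Real.norm_eq_abs, sq_abs]
    calc ((n : ℝ)⁻¹) ^ 2 * ‖∑ i, D i‖ ^ 2 ≤ ((n : ℝ)⁻¹) ^ 2 * (n * ∑ i, ‖D i‖ ^ 2) := by gcongr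
      _ = _ := by field_simp
  have hin : 2 * inner ℝ m ((n : ℝ)⁻¹ • ∑ i, D i) = (n : ℝ)⁻¹ * ∑ i, 2 * inner ℝ (D i) m := by
    rw [real_inner_smul_right, inner_sum, ← Finset.mul_sum]
    simp only [real_inner_comm m]
    ring
  have hterm : ∀ i, 2 * inner ℝ (D i) m + ‖D i‖ ^ 2 ≤ stepEnergy G γ b (x i) (v i) := by
    intro i
    have h1 := hf.le_taylor (x i) (-(γ • g i))
    have h2 := h.norm_sub_sq_le (x i) (-(γ • g i))
    have hGx : (WithLp.toLp 2 fun l => inner ℝ (ψ l (x i)) m : Eu d) = G (x i) := by rw [hG]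
    rw [hGx] at h1
    rw [norm_neg, norm_smul, Real.norm_eq_abs, abs_of_pos hγ, inner_neg_right,
      real_inner_smul_right] at h1
    rw [norm_neg, norm_smul, Real.norm_eq_abs, abs_of_pos hγ] at h2
    have h3 : d * (√κ * ‖m‖) ≤ d * κ * 2 := by
      have : √κ * ‖m‖ ≤ √κ * (2 * √κ) := by gcongr
      have h4 : √κ * (2 * √κ) = 2 * κ := by nlinarith [Real.mul_self_sqrt hκ]
      rw [h4] at this
      calc (d : ℝ) * (√κ * ‖m‖) ≤ d * (2 * κ) := by gcongr
        _ = _ := by ring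
    -- Young's inequality for the cross term between `g i` and `g i - G (x i)`
    have h5 : 2 * inner ℝ (G (x i)) (g i) ≥ 5 / 4 * ‖g i‖ ^ 2 - 4 / 3 * ‖g i - G (x i)‖ ^ 2 := by
      have h6 : 0 ≤ ‖(3 / 4 : ℝ) • g i - (g i - G (x i))‖ ^ 2 := sq_nonneg _
      rw [norm_sub_sq_real, norm_smul, real_inner_smul_left, inner_sub_right,
        real_inner_self_eq_norm_sq, real_inner_comm] at h6
      norm_num at h6
      nlinarith
    have h7 : (γ * ‖g i‖) ^ 2 * (d * (√κ * ‖m‖) + d * κ) ≤ γ * (3 / 16) * ‖g i‖ ^ 2 := by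
      calc (γ * ‖g i‖) ^ 2 * (d * (√κ * ‖m‖) + d * κ)
          ≤ (γ * ‖g i‖) ^ 2 * (3 * (d * κ)) := by gcongr; linarith
        _ = γ * ‖g i‖ ^ 2 * (3 / 16) * (16 * γ * (d * κ)) := by ring
        _ ≤ γ * ‖g i‖ ^ 2 * (3 / 16) * 1 := by gcongr
        _ = _ := by ring
    have h8 : stepEnergy G γ b (x i) (v i)
        = γ * (-(17 / 16) * ‖g i‖ ^ 2 + 4 / 3 * ‖g i - G (x i)‖ ^ 2) := rfl
    rw [h8]
    have h9 : inner ℝ (D i) m = inner ℝ (φ (x i + -(γ • g i))) m - inner ℝ (φ (x i)) m :=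
      inner_sub_left _ _ _
    rw [h9]
    have h10 := mul_le_mul_of_nonneg_left h5 hγ.le
    have h11 : ‖D i‖ ^ 2 ≤ d * κ * (γ * ‖g i‖) ^ 2 := h2
    linarith
  calc ‖m‖ ^ 2 + 2 * inner ℝ m ((n : ℝ)⁻¹ • ∑ i, D i) + ‖(n : ℝ)⁻¹ • ∑ i, D i‖ ^ 2
      ≤ ‖m‖ ^ 2 + (n : ℝ)⁻¹ * ∑ i, 2 * inner ℝ (D i) m + (n : ℝ)⁻¹ * ∑ i, ‖D i‖ ^ 2 := by
        rw [hin]; gcongr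
    _ = ‖m‖ ^ 2 + (n : ℝ)⁻¹ * ∑ i, (2 * inner ℝ (D i) m + ‖D i‖ ^ 2) := by
        rw [Finset.sum_add_distrib]; ring
    _ ≤ _ := by
        gcongr with i
        exact hterm i

/-- Under the noise level condition the mean energy of a step is negative. -/
theorem IsSmoothFeature.sum_integral_stepEnergy_le (h : IsSmoothFeature k κ φ ψ χ) (hκ : 1 ≤ κ)
    {n : ℕ} (hn : 1 ≤ n) (μ : Measure (Eu d)) [IsProbabilityMeasure μ] {γ : ℝ} (hγ : 0 < γ) {b : ℝ}
    (hb : 0 < b) (x : Fin n → Eu d) (hN : NoiseLevel k μ κ b x) {G : Eu d → Eu d}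
    (hG : G = fun z => WithLp.toLp 2 fun l =>
      inner ℝ (ψ l z) (∫ y, φ y ∂(empirical x) - ∫ y, φ y ∂μ)) :
    (n : ℝ)⁻¹ * ∑ i, ∫ u, stepEnergy G γ b (x i) u ∂(stdGaussian (Eu d))
      ≤ -(κ * d ^ 2 * γ * b ^ 2 * mmd k (empirical x) μ ^ 2) := by
  have hn0 : (0 : ℝ) < n := by exact_mod_cast hn
  have := isProbabilityMeasure_empirical hn x
  have hS := h.mmd_eq (empirical x) μ
  set m := ∫ y, φ y ∂(empirical x) - ∫ y, φ y ∂μ with hm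
  have hf := h.hasBoundedHessian m
  rw [← hG] at hf
  have hR : ∀ z, ‖G z‖ ≤ √(d * κ * ‖m‖ ^ 2) := fun z => by
    refine Real.le_sqrt_of_sq_le ?_
    rw [hG]
    exact h.norm_grad_sq_le m z
  have hGc : ∀ i, Continuous fun u : Eu d => G (x i + b • u) := fun i =>
    hf.continuous_grad.comp (by fun_prop)
  have hi1 : ∀ i, Integrable (fun u : Eu d => ‖G (x i + b • u)‖ ^ 2) (stdGaussian (Eu d)) :=
    fun i => Integrable.of_bound ((hGc i).norm.pow 2).aestronglyMeasurable
      (√(d * κ * ‖m‖ ^ 2) ^ 2) (ae_of_all _ fun u => by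
        rw [norm_pow, norm_norm]; exact pow_le_pow_left₀ (norm_nonneg _) (hR _) 2)
  have hi2 : ∀ i, Integrable (fun u : Eu d => ‖G (x i + b • u) - G (x i)‖ ^ 2)
      (stdGaussian (Eu d)) :=
    fun i => Integrable.of_bound (((hGc i).sub continuous_const).norm.pow 2).aestronglyMeasurable
      ((√(d * κ * ‖m‖ ^ 2) + √(d * κ * ‖m‖ ^ 2)) ^ 2) (ae_of_all _ fun u => by
        rw [norm_pow, norm_norm]
        exact pow_le_pow_left₀ (norm_nonneg _)
          ((norm_sub_le _ _).trans (add_le_add (hR _) (hR _))) 2)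
  have hN' : 4 * b ^ 2 * (d : ℝ) ^ 2 * κ ^ 2 * ‖m‖ ^ 2
      ≤ (n : ℝ)⁻¹ * ∑ i, ∫ u, ‖G (x i + b • u)‖ ^ 2 ∂(stdGaussian (Eu d)) := by
    have h1 := hN
    unfold NoiseLevel at h1
    rw [hS] at h1
    refine h1.trans (le_of_eq ?_)
    congr 1
    refine Finset.sum_congr rfl fun i _ => ?_
    have h2 : ∀ v : Fin n → Eu d, ‖(n : ℝ)⁻¹ • ∑ j, Phi k μ (x i + b • v i) (x j)‖ ^ 2
        = ‖G (x i + b • v i)‖ ^ 2 := by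
      intro v
      rw [h.mean_Phi_eq hn, norm_neg, hG]
    simp only [h2]
    unfold gaussianNoise
    exact integral_comp_eval (μ := fun _ : Fin n => stdGaussian (Eu d)) (i := i)
      (f := fun u : Eu d => ‖G (x i + b • u)‖ ^ 2) (hi1 i).aestronglyMeasurable
  have hdiff : ∀ i, ∫ u, ‖G (x i + b • u) - G (x i)‖ ^ 2 ∂(stdGaussian (Eu d))
      ≤ 2 * b ^ 2 * d ^ 2 * κ * ‖m‖ ^ 2 := by
    intro i
    refine (hf.integral_norm_grad_sub_sq_le hR (x i) hb).trans (le_of_eq ?_)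
    have := Real.sq_sqrt h.nonneg
    calc 2 * (b * (d * (√κ * ‖m‖))) ^ 2 = 2 * b ^ 2 * d ^ 2 * (√κ ^ 2) * ‖m‖ ^ 2 := by ring
      _ = _ := by rw [this]
  have hE : ∀ i, ∫ u, stepEnergy G γ b (x i) u ∂(stdGaussian (Eu d))
      ≤ γ * (-(17 / 16) * ∫ u, ‖G (x i + b • u)‖ ^ 2 ∂(stdGaussian (Eu d))
        + 4 / 3 * (2 * b ^ 2 * d ^ 2 * κ * ‖m‖ ^ 2)) := by
    intro i
    simp only [stepEnergy]
    rw [integral_const_mul, integral_add ((hi1 i).const_mul _) ((hi2 i).const_mul _),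
      integral_const_mul, integral_const_mul]
    have := hdiff i
    gcongr
  rw [hS]
  calc (n : ℝ)⁻¹ * ∑ i, ∫ u, stepEnergy G γ b (x i) u ∂(stdGaussian (Eu d))
      ≤ (n : ℝ)⁻¹ * ∑ i, γ * (-(17 / 16) * ∫ u, ‖G (x i + b • u)‖ ^ 2 ∂(stdGaussian (Eu d))
        + 4 / 3 * (2 * b ^ 2 * d ^ 2 * κ * ‖m‖ ^ 2)) := by
        gcongr with i
        exact hE i
    _ = γ * (-(17 / 16) * ((n : ℝ)⁻¹ * ∑ i, ∫ u, ‖G (x i + b • u)‖ ^ 2 ∂(stdGaussian (Eu d)))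
        + 4 / 3 * (2 * b ^ 2 * d ^ 2 * κ * ‖m‖ ^ 2)) := by
        rw [← Finset.mul_sum, Finset.sum_add_distrib, ← Finset.mul_sum, Finset.sum_const,
          Finset.card_univ, Fintype.card_fin, nsmul_eq_mul]
        field_simp
    _ ≤ γ * (-(17 / 16) * (4 * b ^ 2 * (d : ℝ) ^ 2 * κ ^ 2 * ‖m‖ ^ 2)
        + 4 / 3 * (2 * b ^ 2 * d ^ 2 * κ * ‖m‖ ^ 2)) := by
        gcongr γ * (?_ + _)
        linarith
    _ ≤ -(κ * d ^ 2 * γ * b ^ 2 * ‖m‖ ^ 2) := by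
        have h1 : 0 ≤ γ * b ^ 2 * d ^ 2 * ‖m‖ ^ 2 * κ := by positivity
        nlinarith [mul_nonneg h1 (sub_nonneg.2 hκ)]

end Step

/-- One step of the particle system contracts the discrepancy up to a fluctuation of order
`s / √n`, outside an event of probability at most `exp (-s)`. -/
theorem exists_step_bound (d : ℕ) (hd : 1 ≤ d) {κ : ℝ} (hκ : 1 ≤ κ) : ∃ C : ℝ, 0 < C ∧
    ∀ (k : Eu d → Eu d → ℝ) (μ : Measure (Eu d)) [IsProbabilityMeasure μ],
      IsPSDKernel k → IntegrableDifferentiable k μ → KernelRegularity k κ →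
      ∀ γ : ℝ, 0 < γ → 256 * γ ^ 2 * (d : ℝ) ^ 2 * κ ^ 2 ≤ 1 →
      ∀ n : ℕ, 1 ≤ n → ∀ (x : Fin n → Eu d) (b : ℝ), 0 < b → b < 1 → NoiseLevel k μ κ b x →
      ∀ s : ℝ, 1 / 2 ≤ s →
        (gaussianNoise d n).real {v | ¬ mmd k (empirical (step k μ γ b v x)) μ ≤
          Real.exp (-(κ * (d : ℝ) ^ 2 / 2) * (γ * b ^ 2)) * mmd k (empirical x) μ
            + s / √n * (C * max √(γ * b) (1 / √n))} ≤ Real.exp (-s) := by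
  obtain ⟨K, hK, hconc⟩ := exists_concentration d
  -- `5 d² κ² γ b S²` is the growth constant of the energies, one factor `S` is at most `2 κ`,
  -- `exp d` absorbs the contraction factor, and `K + s ≤ s (1 + 2 K)` as `s ≥ 1 / 2`
  refine ⟨5 * d ^ 2 * κ ^ 3 * Real.exp d * (1 + 2 * K), by positivity, ?_⟩
  intro k μ _ hpsd hint hreg γ hγ hγκ n hn x b hb hb1 hN s hs
  obtain ⟨H, _, _, _, φ, ψ, χ, h⟩ := exists_isSmoothFeature hpsd hint hreg
  have hn0 : (0 : ℝ) < n := by exact_mod_cast hn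
  have hsn : 0 < √(n : ℝ) := Real.sqrt_pos.2 hn0
  have hd1 : (1 : ℝ) ≤ d := by exact_mod_cast hd
  have hκ0 : 0 < κ := by linarith
  have hγ16 : 16 * γ * (d * κ) ≤ 1 := by
    have h1 : (16 * γ * (d * κ)) ^ 2 ≤ 1 ^ 2 := by
      rw [one_pow]; refine le_trans (le_of_eq ?_) hγκ; ring
    exact le_of_sq_le_sq h1 zero_le_one
  have := isProbabilityMeasure_empirical hn x
  have hS := h.mmd_eq (empirical x) μ
  set m := ∫ y, φ y ∂(empirical x) - ∫ y, φ y ∂μ with hm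
  set S := mmd k (empirical x) μ with hSdef
  have hS0 : 0 ≤ S := by rw [hS]; exact norm_nonneg _
  have hS2 : S ≤ 2 * κ := by
    rw [hS]
    have h1 := h.norm_integral_le (empirical x)
    have h2 := h.norm_integral_le μ
    have h3 : √κ ≤ κ := by
      rw [Real.sqrt_le_left hκ0.le]; nlinarith
    exact (norm_sub_le _ _).trans (by linarith)
  let G : Eu d → Eu d := fun z => WithLp.toLp 2 fun l => inner ℝ (ψ l z) m
  have hf := h.hasBoundedHessian m
  change HasBoundedHessian _ G _ _ at hf
  have hR : ∀ z, ‖G z‖ ≤ d * κ * S := fun z => by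
    have h1 : ‖G z‖ ^ 2 ≤ d * κ * ‖m‖ ^ 2 := h.norm_grad_sq_le m z
    rw [← hS] at h1
    have h2 : 1 ≤ d * κ := by nlinarith
    refine le_of_sq_le_sq (h1.trans ?_) (by positivity)
    calc d * κ * S ^ 2 ≤ (d * κ) * (d * κ) * S ^ 2 := by
          refine mul_le_mul_of_nonneg_right ?_ (sq_nonneg S)
          exact le_mul_of_one_le_left (by positivity) h2
      _ = _ := by ring
  have hL : ∀ y z, ‖G z - G y‖ ≤ d * κ * S * ‖z - y‖ := fun y z => by
    refine (hf.norm_grad_sub_le y z).trans ?_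
    have h3 : √κ ≤ κ := by
      rw [Real.sqrt_le_left hκ0.le]; nlinarith
    rw [← hS]
    calc d * (√κ * S) * ‖z - y‖ ≤ d * (κ * S) * ‖z - y‖ := by gcongr
      _ = _ := by ring
  set A : ℝ := 5 * γ * (d * κ * S) * (d * κ * S) * b with hA
  have hA0 : 0 ≤ A := by positivity
  have hc := hconc n hn (fun i => stepEnergy G γ b (x i)) A hA0
    (fun i => by
      have hGc : Continuous fun u : Eu d => G (x i + b • u) :=
        hf.continuous_grad.comp (by fun_prop)
      exact (((hGc.norm.pow 2).const_mul _).add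
        (((hGc.sub continuous_const).norm.pow 2).const_mul _)).const_mul γ)
    (fun i v => abs_stepEnergy_sub_le hγ.le hb.le hR hL (x i) v) s
  refine le_trans (measureReal_mono ?_ (by
    have : IsProbabilityMeasure (gaussianNoise d n) := by
      unfold gaussianNoise; infer_instance
    exact measure_ne_top _ _)) hc
  intro v hv
  simp only [Set.mem_ofPred_eq] at hv ⊢
  by_contra hcon
  refine hv ?_
  rw [not_lt] at hcon
  have hstep := h.mmd_step_sq_le hn μ hγ hγ16 b v x (G := G) rfl
  have hmean := h.sum_integral_stepEnergy_le hκ hn μ hγ hb x hN (G := G) rfl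
  rw [← hSdef] at hstep hmean
  set E := Real.exp (-(κ * (d : ℝ) ^ 2 / 2) * (γ * b ^ 2)) with hE
  have hγ1 : γ * (d * κ) ≤ 1 := by
    have : 0 ≤ γ * (d * κ) := by positivity
    linarith
  have hγle : γ ≤ 1 :=
    (le_mul_of_one_le_right hγ.le (one_le_mul_of_one_le_of_one_le hd1 hκ)).trans hγ1
  have hE2 : 1 - κ * d ^ 2 * γ * b ^ 2 ≤ E ^ 2 := by
    rw [hE, ← Real.exp_nat_mul]
    refine le_trans (le_of_eq ?_) (Real.add_one_le_exp _)
    push_cast; ring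
  have hElow : 1 ≤ E * Real.exp d := by
    rw [hE, ← Real.exp_add]
    refine Real.one_le_exp ?_
    have h1 : κ * (d : ℝ) ^ 2 / 2 * (γ * b ^ 2) = (γ * (d * κ)) * b ^ 2 * d / 2 := by ring
    have h2 : (γ * (d * κ)) * b ^ 2 * d / 2 ≤ 1 * 1 * d / 2 := by
      gcongr
      exact pow_le_one₀ hb.le hb1.le
    linarith
  set q := s / √n * (5 * d ^ 2 * κ ^ 3 * Real.exp d * (1 + 2 * K) * max √(γ * b) (1 / √n)) with hq
  have hmax : γ * b ≤ max √(γ * b) (1 / √(n : ℝ)) := by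
    refine le_trans ?_ (le_max_left _ _)
    refine Real.le_sqrt_of_sq_le ?_
    have h1 : γ * b ≤ 1 := mul_le_one₀ hγle hb.le hb1.le
    have h2 : 0 ≤ γ * b := by positivity
    rw [sq]
    exact mul_le_of_le_one_left h2 h1
  have hq0 : 0 ≤ q := by positivity
  have hkey : A * (K + s) / √n ≤ 2 * (E * S) * q := by
    have h1 : K + s ≤ s * (1 + 2 * K) := by
      have := mul_le_mul_of_nonneg_right hs hK.le
      linarith
    calc A * (K + s) / √n ≤ A * (s * (1 + 2 * K)) / √n := by gcongr
      _ = (5 * d ^ 2 * κ ^ 2) * (S * S) * (γ * b) * (s / √n) * (1 + 2 * K) * 1 := by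
          rw [hA]; ring
      _ ≤ (5 * d ^ 2 * κ ^ 2) * (S * (2 * κ)) * max √(γ * b) (1 / √(n : ℝ)) * (s / √n) * (1 + 2 * K)
          * (E * Real.exp d) := by gcongr
      _ = 2 * (E * S) * q := by rw [hq]; ring
  have hsum : (n : ℝ)⁻¹ * ∑ i, stepEnergy G γ b (x i) (v i)
      ≤ -(κ * d ^ 2 * γ * b ^ 2 * S ^ 2) + A * (K + s) / √n := by
    have h1 : (n : ℝ)⁻¹ * ∑ i, stepEnergy G γ b (x i) (v i)
        ≤ (n : ℝ)⁻¹ * (∑ i, ∫ u, stepEnergy G γ b (x i) u ∂(stdGaussian (Eu d))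
          + √n * (A * (K + s))) := by
      gcongr
      linarith
    have h2 : (n : ℝ)⁻¹ * (√n * (A * (K + s))) = A * (K + s) / √n := by
      have h3 : (n : ℝ) = √n * √n := (Real.mul_self_sqrt hn0.le).symm
      nth_rewrite 1 [h3]
      field_simp
    rw [mul_add, h2] at h1
    linarith
  have hfin : mmd k (empirical (step k μ γ b v x)) μ ^ 2 ≤ (E * S + q) ^ 2 := by
    have h1 : (1 - κ * d ^ 2 * γ * b ^ 2) * S ^ 2 ≤ E ^ 2 * S ^ 2 := by gcongr
    have h2 : (E * S + q) ^ 2 = E ^ 2 * S ^ 2 + 2 * (E * S) * q + q ^ 2 := by ring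
    linarith [sq_nonneg q]
  exact le_of_sq_le_sq hfin (by positivity)

end

/-! ### The run of the algorithm -/

section Measurability

variable {d : ℕ} {k : Eu d → Eu d → ℝ} {κ : ℝ} {H : Type*} [NormedAddCommGroup H]
  [InnerProductSpace ℝ H] [CompleteSpace H] {φ : Eu d → H} {ψ : Fin d → Eu d → H}
  {χ : Fin d → Fin d → Eu d → H}

theorem IsSmoothFeature.continuous_mmd_empirical (h : IsSmoothFeature k κ φ ψ χ) {n : ℕ}
    (hn : 1 ≤ n) (μ : Measure (Eu d)) [IsProbabilityMeasure μ] :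
    Continuous fun x : Fin n → Eu d => mmd k (empirical x) μ := by
  have e : (fun x : Fin n → Eu d => mmd k (empirical x) μ)
      = fun x => ‖(n : ℝ)⁻¹ • ∑ i, φ (x i) - ∫ y, φ y ∂μ‖ := by
    ext x
    have := isProbabilityMeasure_empirical hn x
    rw [h.mmd_eq, integral_empirical]
  rw [e]
  have := h.continuous
  fun_prop

theorem IsSmoothFeature.continuous_step (h : IsSmoothFeature k κ φ ψ χ) (n : ℕ) (μ : Measure (Eu d))
    [IsProbabilityMeasure μ] (γ : ℝ) :
    Continuous fun p : ((Fin n → Eu d) × ℝ) × (Fin n → Eu d) =>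
      step k μ γ p.1.2 p.2 p.1.1 := by
  have hφ := h.continuous
  have hψ : ∀ l, Continuous (ψ l) := fun l => continuous_iff_continuousAt.2 fun x =>
    (hasFDerivAt_of_partial (h.hasLineDerivAt₂ l) (h.continuous₂ l) x).continuousAt
  unfold step
  simp only [h.drift_eq, integral_empirical]
  refine continuous_pi fun i => ?_
  refine Continuous.sub (by fun_prop) (Continuous.const_smul ?_ γ)
  refine (PiLp.continuous_toLp 2 _).comp (continuous_pi fun l => ?_)
  exact Continuous.inner ((hψ l).comp (by fun_prop)) (by fun_prop)

end Measurability

/-- A bound for the conditional probability of an event given the past bounds its probability: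
here the past is carried by `Y` and the fresh noise by `u`. -/
theorem measure_le_of_indep {Ω Z V : Type*} {𝒢 : MeasurableSpace Ω} [mΩ : MeasurableSpace Ω]
    [MeasurableSpace Z] [MeasurableSpace V] {Pr : Measure Ω} [IsProbabilityMeasure Pr]
    (h𝒢 : 𝒢 ≤ mΩ) {Y : Ω → Z} (hY : Measurable[𝒢] Y) {u : Ω → V} (hu : Measurable u)
    (hind : Indep (MeasurableSpace.comap u inferInstance) 𝒢 Pr) {E : Set (Z × V)}
    (hE : MeasurableSet E) {c : ℝ≥0∞}
    (hc : ∀ᵐ ω ∂Pr, Pr.map u {v | (Y ω, v) ∈ E} ≤ c) : Pr {ω | (Y ω, u ω) ∈ E} ≤ c := by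
  have hY' : Measurable Y := hY.mono h𝒢 le_rfl
  have hYu : IndepFun Y u Pr := by
    have h1 : Indep (MeasurableSpace.comap Y inferInstance) (MeasurableSpace.comap u inferInstance)
      Pr := (indep_of_indep_of_le_right hind hY.comap_le).symm
    exact h1
  have hmap := (indepFun_iff_map_prod_eq_prod_map_map hY'.aemeasurable hu.aemeasurable).1 hYu
  have := Measure.isProbabilityMeasure_map (μ := Pr) hu.aemeasurable
  have h2 : Pr {ω | (Y ω, u ω) ∈ E} = Pr.map (fun ω => (Y ω, u ω)) E := by
    rw [Measure.map_apply (hY'.prodMk hu) hE]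
    rfl
  rw [h2, hmap, Measure.prod_apply hE, lintegral_map (measurable_measure_prodMk_left hE) hY']
  calc ∫⁻ ω, Pr.map u (Prod.mk (Y ω) ⁻¹' E) ∂Pr ≤ ∫⁻ _ω, c ∂Pr := lintegral_mono_ae hc
    _ = c := by simp

/-- Unrolling a linear recursive inequality with exponential contraction factors. -/
theorem le_of_recursive_contraction {a e r : ℕ → ℝ} {c ρ C : ℝ} {N : ℕ} (hN : 1 ≤ N)
    (h : ∀ t ∈ Finset.Ico 1 N, a (t + 1) ≤ Real.exp (-c * e t) * a t + ρ * (C * r t)) :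
    a N ≤ Real.exp (-c * ∑ t ∈ Finset.Ico 1 N, e t) * a 1
      + ρ * (C * ∑ t ∈ Finset.Ico 1 N, r t * Real.exp (-c * ∑ s ∈ Finset.Ico (t + 1) N, e s)) := by
  induction N, hN using Nat.le_induction with
  | base => simp
  | succ N hN ih =>
    have h1 := h N (Finset.mem_Ico.2 ⟨hN, Nat.lt_succ_self N⟩)
    have h2 := ih fun t ht => h t (by
      rw [Finset.mem_Ico] at ht ⊢
      exact ⟨ht.1, ht.2.trans (Nat.lt_succ_self N)⟩)
    have h3 : ∑ t ∈ Finset.Ico 1 N, r t * Real.exp (-c * ∑ s ∈ Finset.Ico (t + 1) (N + 1), e s)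
        = Real.exp (-c * e N)
          * ∑ t ∈ Finset.Ico 1 N, r t * Real.exp (-c * ∑ s ∈ Finset.Ico (t + 1) N, e s) := by
      rw [Finset.mul_sum]
      refine Finset.sum_congr rfl fun t ht => ?_
      have ht' := (Finset.mem_Ico.1 ht).2
      rw [Finset.sum_Ico_succ_top (by omega), mul_add, Real.exp_add]
      ring
    rw [Finset.sum_Ico_succ_top hN, Finset.sum_Ico_succ_top hN, h3, mul_add, Real.exp_add]
    have h4 := mul_le_mul_of_nonneg_left h2 (Real.exp_pos (-c * e N)).le
    simp only [Finset.Ico_self, Finset.sum_empty, mul_zero, Real.exp_zero, mul_one]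
    linarith

/-- The particles at time `t` are determined by the past. -/
theorem IsNoisyDescent.measurable {d n : ℕ} {k : Eu d → Eu d → ℝ} {μ : Measure (Eu d)} {γ : ℝ}
    (hstep : Continuous fun p : ((Fin n → Eu d) × ℝ) × (Fin n → Eu d) =>
      step k μ γ p.1.2 p.2 p.1.1)
    {Ω : Type*} [mΩ : MeasurableSpace Ω] {Pr : Measure Ω} {ℱ : Filtration ℕ mΩ}
    {β : ℕ → Ω → ℝ} {u X : ℕ → Ω → Fin n → Eu d} {x₁ : Fin n → Eu d}
    (hX : IsNoisyDescent Pr ℱ k μ γ β u X x₁) {t : ℕ} (ht : 1 ≤ t) : Measurable[ℱ t] (X t) := by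
  induction t, ht using Nat.le_induction with
  | base =>
    have : X 1 = fun _ => x₁ := funext hX.init
    rw [this]
    exact measurable_const
  | succ t ht ih =>
    have hle : ℱ t ≤ ℱ (t + 1) := ℱ.mono (Nat.le_succ t)
    have e : X (t + 1) = (fun p : ((Fin n → Eu d) × ℝ) × (Fin n → Eu d) =>
        step k μ γ p.1.2 p.2 p.1.1) ∘ fun ω => ((X t ω, β t ω), u t ω) :=
      funext fun ω => hX.update t ht ω
    rw [e]
    have h1 : Measurable[ℱ (t + 1)] (X t) := ih.mono hle le_rfl
    have h2 : Measurable[ℱ (t + 1)] (β t) := (hX.level_measurable t ht).mono hle le_rfl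
    exact hstep.measurable.comp ((h1.prodMk h2).prodMk (hX.noise_measurable t ht))

end MMDFlow

theorem mainTheorem2 (d : ℕ) (κ : ℝ) (hκ : 1 ≤ κ) :
    ∃ C : ℝ, 0 < C ∧
      ∀ (k : MMDFlow.Eu d → MMDFlow.Eu d → ℝ) (μ : Measure (MMDFlow.Eu d))
        [IsProbabilityMeasure μ],
        MMDFlow.IsPSDKernel k → MMDFlow.IntegrableDifferentiable k μ →
        MMDFlow.KernelRegularity k κ →
      ∀ (γ : ℝ), 0 < γ → 256 * γ ^ 2 * (d : ℝ) ^ 2 * κ ^ 2 ≤ 1 →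
      ∀ (n : ℕ), 1 ≤ n →
      ∀ {Ω : Type*} [mΩ : MeasurableSpace Ω] (Pr : Measure Ω) [IsProbabilityMeasure Pr]
        (ℱ : Filtration ℕ mΩ) (β : ℕ → Ω → ℝ) (u X : ℕ → Ω → Fin n → MMDFlow.Eu d)
        (x₁ : Fin n → MMDFlow.Eu d),
        MMDFlow.IsNoisyDescent Pr ℱ k μ γ β u X x₁ →
        (∀ t, 1 ≤ t → ∀ ω, 0 < β t ω ∧ β t ω < 1) →
        (∀ t, 1 ≤ t → ∀ᵐ ω ∂Pr, MMDFlow.NoiseLevel k μ κ (β t ω) (X t ω)) →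
      ∀ (T : ℕ), 1 ≤ T → ∀ (δ : ℝ), 0 < δ →
        1 - Real.exp (-δ) ≤ Pr.real {ω |
          MMDFlow.mmd k (MMDFlow.empirical (X T ω)) μ ≤
            Real.exp (-(κ * (d : ℝ) ^ 2 / 2) * ∑ t ∈ Finset.Ico 1 T, γ * β t ω ^ 2)
              * MMDFlow.mmd k (MMDFlow.empirical (X 1 ω)) μ
            + (δ + Real.log T) / Real.sqrt n *
              (C * ∑ t ∈ Finset.Ico 1 T,
                max (Real.sqrt (γ * β t ω)) (1 / Real.sqrt n) *
                  Real.exp (-(κ * (d : ℝ) ^ 2 / 2) *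
                    ∑ s ∈ Finset.Ico (t + 1) T, γ * β s ω ^ 2))} := by
  open MMDFlow in
  rcases Nat.eq_zero_or_pos d with rfl | hd
  · -- In dimension zero nothing moves.
    refine ⟨1, one_pos, ?_⟩
    intro k μ _ _ _ _ γ _ _ n _ Ω mΩ Pr _ ℱ β u X x₁ _ _ _ T hT δ hδ
    have hT1 : (1 : ℝ) ≤ T := by exact_mod_cast hT
    have hlog := Real.log_nonneg hT1
    refine le_trans (sub_le_self 1 (Real.exp_pos _).le) (le_of_eq ?_)
    rw [← probReal_univ (μ := Pr)]
    congr 1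
    symm
    refine Set.eq_univ_of_forall fun ω => ?_
    rw [Set.mem_ofPred_eq, Subsingleton.elim (X T ω) (X 1 ω)]
    have h0 : Real.exp (-(κ * ((0 : ℕ) : ℝ) ^ 2 / 2) * ∑ t ∈ Finset.Ico 1 T, γ * β t ω ^ 2) = 1 := by
      simp
    rw [h0, one_mul]
    refine le_add_of_nonneg_right ?_
    positivity
  obtain ⟨C, hC, hstepb⟩ := exists_step_bound d hd hκ
  refine ⟨C, hC, ?_⟩
  intro k μ _ hpsd hint hreg γ hγ hγκ n hn Ω mΩ Pr _ ℱ β u X x₁ hX hβ hN T hT δ hδ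
  obtain ⟨H, _, _, _, φ, ψ, χ, h⟩ := exists_isSmoothFeature hpsd hint hreg
  have hT0 : (0 : ℝ) < T := by exact_mod_cast hT
  set s := δ + Real.log T with hs
  -- `s` is chosen so that the `T - 1` failure probabilities `exp (-s)` sum to at most `exp (-δ)`
  let Bad : ℕ → Set Ω := fun t => {ω | ¬ mmd k (empirical (X (t + 1) ω)) μ ≤
    Real.exp (-(κ * (d : ℝ) ^ 2 / 2) * (γ * β t ω ^ 2)) * mmd k (empirical (X t ω)) μ
      + s / √n * (C * max √(γ * β t ω) (1 / √n))}
  have hstepc := h.continuous_step n μ γ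
  have hmmd := h.continuous_mmd_empirical hn μ
  have hBad : ∀ t ∈ Finset.Ico 1 T, Pr.real (Bad t) ≤ Real.exp (-s) := by
    intro t ht
    rw [Finset.mem_Ico] at ht
    -- a step takes place only if `T ≥ 2`, and then `s ≥ log 2`
    have hs2 : 1 / 2 ≤ s := by
      have h1 : Real.log 2 ≤ Real.log T := by
        refine Real.log_le_log two_pos ?_
        have : 2 ≤ T := by omega
        exact_mod_cast this
      have h2 := Real.log_two_gt_d9
      linarith
    -- the bad event in terms of particles, noise level and fresh noise
    let E : Set (((Fin n → Eu d) × ℝ) × (Fin n → Eu d)) :=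
      {p | ¬ mmd k (empirical (step k μ γ p.1.2 p.2 p.1.1)) μ ≤
        Real.exp (-(κ * (d : ℝ) ^ 2 / 2) * (γ * p.1.2 ^ 2)) * mmd k (empirical p.1.1) μ
          + s / √n * (C * max √(γ * p.1.2) (1 / √n))}
    have hE : MeasurableSet E := by
      have h1 := hmmd.comp hstepc
      have h2 : Continuous fun p : ((Fin n → Eu d) × ℝ) × (Fin n → Eu d) =>
          mmd k (empirical p.1.1) μ := hmmd.comp (continuous_fst.comp continuous_fst)
      exact (isClosed_le h1 (by fun_prop)).measurableSet.compl
    have hu : Measurable (u t) := (hX.noise_measurable t ht.1).mono (ℱ.le _) le_rfl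
    have hY : Measurable[ℱ t] fun ω => (X t ω, β t ω) :=
      (hX.measurable hstepc ht.1).prodMk (hX.level_measurable t ht.1)
    have key := measure_le_of_indep (ℱ.le t) hY hu (hX.noise_indep t ht.1) hE
      (c := ENNReal.ofReal (Real.exp (-s))) (by
        filter_upwards [hN t ht.1] with ω hω
        have hb := hβ t ht.1 ω
        have h1 := hstepb k μ hpsd hint hreg γ hγ hγκ n hn (X t ω) (β t ω) hb.1 hb.2 hω s hs2
        have hprob : IsProbabilityMeasure (gaussianNoise d n) := by
          unfold gaussianNoise; infer_instance
        rw [hX.noise_law t ht.1]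
        rw [measureReal_def] at h1
        exact (ENNReal.le_ofReal_iff_toReal_le (measure_ne_top _ _) (Real.exp_pos _).le).2 h1)
    have e : Bad t = {ω | ((X t ω, β t ω), u t ω) ∈ E} := by
      ext ω
      simp only [Bad, E, Set.mem_ofPred_eq]
      rw [hX.update t ht.1 ω]
    rw [e, measureReal_def]
    exact ENNReal.toReal_le_of_le_ofReal (Real.exp_pos _).le key
  set Good : Set Ω := {ω | _}
  have hcover : (Set.univ : Set Ω) ⊆ Good ∪ ⋃ t ∈ Finset.Ico 1 T, Bad t := by
    intro ω _
    by_cases hω : ω ∈ ⋃ t ∈ Finset.Ico 1 T, Bad t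
    · exact Or.inr hω
    · refine Or.inl ?_
      refine le_of_recursive_contraction (a := fun t => mmd k (empirical (X t ω)) μ)
        (e := fun t => γ * β t ω ^ 2) (r := fun t => max √(γ * β t ω) (1 / √n)) hT fun t ht => ?_
      by_contra hcon
      exact hω (Set.mem_biUnion ht hcon)
  have hunion : Pr.real (⋃ t ∈ Finset.Ico 1 T, Bad t) ≤ Real.exp (-δ) := by
    refine (measureReal_biUnion_finset_le _ _).trans ((Finset.sum_le_sum hBad).trans ?_)
    rw [Finset.sum_const, Nat.card_Ico, nsmul_eq_mul, hs, neg_add, Real.exp_add,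
      Real.exp_neg (Real.log T), Real.exp_log hT0]
    have h1 : ((T - 1 : ℕ) : ℝ) ≤ T := by exact_mod_cast Nat.sub_le T 1
    calc ((T - 1 : ℕ) : ℝ) * (Real.exp (-δ) * (T : ℝ)⁻¹)
        ≤ T * (Real.exp (-δ) * (T : ℝ)⁻¹) := by gcongr
      _ = Real.exp (-δ) := by field_simp
  have h1 := (measureReal_mono (μ := Pr) hcover (measure_ne_top _ _)).trans
    (measureReal_union_le _ _)
  rw [probReal_univ] at h1
  linarith
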